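/- **Theorem 8.1 (Learning histograms).** For distributions $\mu,\tau$ over $\Omega=\{1,\dots,N\}$ let $$D_{\mathrm H}(\mu;\tau)=\min\Bigl\{\delta\ge 0 : \min_{\pi}\Pr_{x\sim\mu}\bigl[\mu(x)\notin[(1-\delta)\,\tau(\pi(x)),\,(1+\delta)\,\tau(\pi(x))]\bigr]\le\delta\Bigr\},$$ where $\pi$ ranges over all permutations of $\Omega$. A conditional sampling oracle for $\mu$ receives a set $A\subseteq\Omega$ and, if $\mu(A)>0$, returns a fresh sample of $\mu$ conditioned on $A$; if $\mu(A)=0$, its answer (an element of $\Omega$ or an error symbol) may follow an arbitrary distribution determined by $A$. There is a polynomial $P$ with real coefficients such that for every integer $N\ge 3$ and every $\varepsilon\in(0,1)$ there is a randomized adaptive algorithm that makes at most $$\frac{\log N\cdot\log\log N}{\varepsilon^{7}}\cdot P\bigl(\log\varepsilon^{-1}\bigr)$$ conditional samples (on every execution path; private random bits are free) and solves the $\varepsilon$-histogram learning task: for every distribution $\mu$ over $\{1,\dots,N\}$ and every conditional sampling oracle for $\mu$, with probability greater than $2/3$ it outputs a distribution $\tau$ over $\{1,\dots,N\}$ with $D_{\mathrm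 H}(\mu;\tau)\le\varepsilon$. -/

import Mathlib

/-- A randomized adaptive algorithm with conditional sampling access to an unknown distribution
over `Fin N`, returning an element of `R`. It may return a value, toss private coins (draw from any
discrete distribution of its choice, free of charge), or ask for a sample conditioned on a set
`A ⊆ Fin N` and continue according to the answer. The answer `none` is an error symbol, which an
oracle may give only when `A` has probability zero. -/
inductive CondAlg (N : ℕ) (R : Type) : Type 1
  | output (r : R) : CondAlg N R
  | toss {ι : Type} (p : PMF ι) (next : ι → CondAlg N R) : CondAlg N R
  | query (A : Set (Fin N)) (next : Option (Fin N) → CondAlg N R) : CondAlg N R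

/-- On every execution path the algorithm requests at most `q` conditional samples. -/
def CondAlg.UsesAtMost {N : ℕ} {R : Type} : CondAlg N R → ℕ → Prop
  | .output _, _ => True
  | .toss _ next, q => ∀ i, (next i).UsesAtMost q
  | .query _ _, 0 => False
  | .query _ next, q + 1 => ∀ y, (next y).UsesAtMost q

/-- The distribution of the output when every request for a sample conditioned on `A` is answered
by a fresh draw from `O A`, independent of everything that happened before. -/
noncomputable def CondAlg.run {N : ℕ} {R : Type} (O : Set (Fin N) → PMF (Option (Fin N))) :
    CondAlg N R → PMF R
  | .output r => PMF.pure r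
  | .toss p next => p.bind fun i => (next i).run O
  | .query A next => (O A).bind fun y => (next y).run O

/-- `O` is a conditional sampling oracle for `μ`: if `μ(A) > 0`, its answer to `A` is distributed
like `μ` conditioned on `A`. On probability-zero sets its behaviour is arbitrary (an error symbol,
a uniform element of `A`, ...), so all variants of the model are covered. -/
def IsCondOracle {N : ℕ} (μ : PMF (Fin N)) (O : Set (Fin N) → PMF (Option (Fin N))) : Prop :=
  ∀ (A : Set (Fin N)) (h : ∃ x ∈ A, x ∈ μ.support), O A = (μ.filter A h).map some

open Classical in
/-- `Pr_{x ∼ μ} [μ(x) ∉ (1 ± δ) τ(π(x))]`. -/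
noncomputable def mismatchProb {N : ℕ} (μ τ : PMF (Fin N)) (π : Equiv.Perm (Fin N)) (δ : ℝ) : ℝ :=
  ∑ x with (μ x).toReal ∉ Set.Icc ((1 - δ) * (τ (π x)).toReal) ((1 + δ) * (τ (π x)).toReal),
    (μ x).toReal

/-- The histogram divergence `D_H(μ ; τ)`: the least `δ ≥ 0` such that some permutation `π` of the
domain has `Pr_{x ∼ μ} [μ(x) ∉ (1 ± δ) τ(π(x))] ≤ δ`. The set is nonempty (it contains `1`) and the
infimum is attained. -/
noncomputable def histDiv {N : ℕ} (μ τ : PMF (Fin N)) : ℝ :=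
  sInf {δ : ℝ | 0 ≤ δ ∧ ∃ π : Equiv.Perm (Fin N), mismatchProb μ τ π δ ≤ δ}

/-- The algorithm solves the `ε`-histogram learning task: for every input distribution `μ` over
`Fin N` and every conditional sampling oracle for `μ`, with probability more than `2/3` it returns
a distribution `τ` over `Fin N` with `D_H(μ ; τ) ≤ ε`. -/
def CondAlg.LearnsHistogram {N : ℕ} (𝒜 : CondAlg N (PMF (Fin N))) (ε : ℝ) : Prop :=
  ∀ (μ : PMF (Fin N)) (O : Set (Fin N) → PMF (Option (Fin N))), IsCondOracle μ O →
    2 / 3 < (𝒜.run O).toOuterMeasure {τ | histDiv μ τ ≤ ε}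

/-!
The mass of a single element `x` of mass `p` is estimated through two smoothed statistics that only
involve comparisons with `x`: `lightMass = ∑ y, μ y * p / (p + μ y)`, the success probability of
the experiment "draw `y`, then sample from `{x, y}` and see `x`", and
`heavyCount = ∑ y, μ y / (p + μ y)`. Since `p * heavyCount = lightMass` (`mul_heavyCount`), it
suffices to estimate both. The first is bounded below outside a small quantile of the mass
(`sum_lightMass_lt_le`), so that its empirical value is accurate. For the second, a random set `A`
of density `q` is drawn, and a sample conditioned on `A ∪ {x}` is compared with `x`; with
`a = q * heavyCount`, the chance of not seeing `x` lies between `a / (1 + a)` and `a`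
(`ex_hitProb_le`, `le_ex_hitProb`). This holds for every distribution, with no concentration
assumption on the mass of `A`.

The density at which that chance crosses a threshold of order `ε` is located by binary search in a
geometric grid of about `log (N / ε) / ε` points. The tests are repeated about `ε⁻⁴` times. A test
at distance `d` from the true position fails with probability of order `ε / d²`, which is summable
over the grid (`sum_inv_sq_le`), so no further repetition is needed to make all steps of the search
succeed (`CondAlg.search_error`), and an estimate costs `log log N / ε⁴` samples up to factors
`log (1 / ε)`.

About `log (N / ε) / ε³` independent elements are drawn and put into buckets in this way, enough
for the empirical bucket histogram to be close to its expectation in `L¹`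
(`CondAlg.toOuterMeasure_empirical_le`). The algorithm returns any distribution `τ` that could
have caused this histogram (`Explains`). As `μ` itself is such a distribution
(`explains_of_sum_abs_le`), composing the two explanations couples `μ` and `τ` along pairs of
elements of nearly equal mass; Birkhoff's theorem turns this fractional matching into a permutation
(`Explains.histDiv_le`).
-/

/-! ### Composing algorithms -/

namespace CondAlg

variable {N : ℕ} {R R' : Type}

/-- Sequential composition: run an algorithm and continue according to its result. -/
noncomputable def bind : CondAlg N R → (R → CondAlg N R') → CondAlg N R'
  | .output r, f => f r
  | .toss p next, f => .toss p fun i => (next i).bind f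
  | .query A next, f => .query A fun y => (next y).bind f

theorem run_bind (O : Set (Fin N) → PMF (Option (Fin N))) (a : CondAlg N R)
    (f : R → CondAlg N R') : (a.bind f).run O = (a.run O).bind fun r => (f r).run O := by
  induction a with
  | output r => simp [bind, run]
  | toss p next ih => simp [bind, run, ih]
  | query A next ih => simp [bind, run, ih]

theorem UsesAtMost.mono {a : CondAlg N R} {q q' : ℕ} (h : a.UsesAtMost q) (hq : q ≤ q') :
    a.UsesAtMost q' := by
  induction a generalizing q q' with
  | output r => trivial
  | toss p next ih => exact fun i => ih i (h i) hq
  | query A next ih =>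
    obtain _ | q := q
    · exact h.elim
    · obtain _ | q' := q'
      · omega
      · exact fun y => ih y (h y) (by omega)

theorem UsesAtMost.bind {a : CondAlg N R} {f : R → CondAlg N R'} {q q' : ℕ}
    (h : a.UsesAtMost q) (hf : ∀ r, (f r).UsesAtMost q') : (a.bind f).UsesAtMost (q + q') := by
  induction a generalizing q with
  | output r => exact (hf r).mono (by omega)
  | toss p next ih => exact fun i => ih i (h i)
  | query A next ih =>
    obtain _ | q := q
    · exact h.elim
    · rw [Nat.add_right_comm]
      exact fun y => ih y (h y)

/-- `n` independent runs of the same algorithm. -/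
noncomputable def rep (a : CondAlg N R) : (n : ℕ) → CondAlg N (Fin n → R)
  | 0 => .output Fin.elim0
  | n + 1 => a.bind fun r => (rep a n).bind fun g => .output (Fin.cons r g)

theorem UsesAtMost.rep {a : CondAlg N R} {q : ℕ} (h : a.UsesAtMost q) (n : ℕ) :
    (a.rep n).UsesAtMost (n * q) := by
  induction n with
  | zero => trivial
  | succ n ih =>
    rw [Nat.succ_mul, Nat.add_comm (n * q)]
    refine h.bind fun r => ?_
    exact (ih.bind (q' := 0) fun g => trivial)

end CondAlg

/-! ### Expectations and tail bounds -/

namespace PMF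

variable {R R' : Type}

/-- The expectation of a real function on a finite probability space. -/
noncomputable def ex [Fintype R] (P : PMF R) (F : R → ℝ) : ℝ := ∑ a, (P a).toReal * F a

theorem sum_toReal [Fintype R] (P : PMF R) : ∑ a, (P a).toReal = 1 := by
  rw [← ENNReal.toReal_sum fun a _ => P.apply_ne_top a, ← tsum_fintype (L := .unconditional _),
    P.tsum_coe, ENNReal.toReal_one]

section
variable [Fintype R] [Fintype R'] (P : PMF R)

theorem ex_const (c : ℝ) : P.ex (fun _ => c) = c := by
  simp [ex, ← Finset.sum_mul, sum_toReal]

theorem ex_add (F G : R → ℝ) : P.ex (fun a => F a + G a) = P.ex F + P.ex G := by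
  simp [ex, mul_add, Finset.sum_add_distrib]

theorem ex_mul_left (c : ℝ) (F : R → ℝ) : P.ex (fun a => c * F a) = c * P.ex F := by
  simp only [ex, Finset.mul_sum]
  exact Finset.sum_congr rfl fun a _ => by ring

theorem ex_mul_right (c : ℝ) (F : R → ℝ) : P.ex (fun a => F a * c) = P.ex F * c := by
  simp only [mul_comm _ c, ex_mul_left]

theorem ex_sum {ι : Type} (s : Finset ι) (F : ι → R → ℝ) :
    P.ex (fun a => ∑ i ∈ s, F i a) = ∑ i ∈ s, P.ex (F i) := by
  simp only [ex, Finset.mul_sum]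
  exact Finset.sum_comm

theorem ex_mono {F G : R → ℝ} (h : ∀ a, F a ≤ G a) : P.ex F ≤ P.ex G :=
  Finset.sum_le_sum fun a _ => mul_le_mul_of_nonneg_left (h a) ENNReal.toReal_nonneg

theorem ex_bind (f : R → PMF R') (F : R' → ℝ) :
    (P.bind f).ex F = P.ex fun a => (f a).ex F := by
  have h : ∀ b, ((P.bind f) b).toReal = ∑ a, (P a).toReal * (f a b).toReal := fun b => by
    rw [bind_apply, tsum_fintype, ENNReal.toReal_sum fun a _ =>
      ENNReal.mul_ne_top (P.apply_ne_top a) ((f a).apply_ne_top b)]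
    simp
  simp only [ex, h, Finset.sum_mul, Finset.mul_sum]
  rw [Finset.sum_comm]
  exact Finset.sum_congr rfl fun a _ => Finset.sum_congr rfl fun b _ => by ring

theorem ex_pure (a : R) (F : R → ℝ) : (PMF.pure a).ex F = F a := by
  classical
  simp [ex, PMF.pure_apply, apply_ite ENNReal.toReal]

/-- Markov's inequality. -/
theorem toOuterMeasure_le_ex (B : Set R) (F : R → ℝ) (h0 : ∀ a, 0 ≤ F a)
    (h1 : ∀ a ∈ B, 1 ≤ F a) : P.toOuterMeasure B ≤ ENNReal.ofReal (P.ex F) := by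
  rw [toOuterMeasure_apply, tsum_fintype, ex,
    ENNReal.ofReal_sum_of_nonneg fun a _ => mul_nonneg ENNReal.toReal_nonneg (h0 a)]
  refine Finset.sum_le_sum fun a _ => ?_
  rw [ENNReal.ofReal_mul ENNReal.toReal_nonneg, ENNReal.ofReal_toReal (P.apply_ne_top a)]
  by_cases ha : a ∈ B
  · rw [Set.indicator_of_mem ha]
    exact le_mul_of_one_le_right' (ENNReal.one_le_ofReal.2 (h1 a ha))
  · simp [ha]

end

/-- Union bound for a two-stage experiment. -/
theorem toOuterMeasure_bind_le (P : PMF R) (f : R → PMF R') (B : Set R') (C : Set R)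
    (c : ENNReal) (h : ∀ a ∉ C, (f a).toOuterMeasure B ≤ c) :
    (P.bind f).toOuterMeasure B ≤ P.toOuterMeasure C + c := by
  have hle : ∀ a, (f a).toOuterMeasure B ≤ 1 := fun a =>
    ((f a).toOuterMeasure.mono (Set.subset_univ B)).trans_eq
      (((f a).toOuterMeasure_apply_eq_one_iff _).2 (Set.subset_univ _))
  rw [toOuterMeasure_bind_apply, toOuterMeasure_apply]
  calc ∑' a, P a * (f a).toOuterMeasure B
      ≤ ∑' a, (C.indicator P a + P a * c) := by
        refine ENNReal.tsum_le_tsum fun a => ?_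
        by_cases ha : a ∈ C
        · rw [Set.indicator_of_mem ha]
          exact (mul_le_of_le_one_right' (hle a)).trans le_self_add
        · rw [Set.indicator_of_notMem ha, zero_add]
          exact mul_le_mul_right (h a ha) _
    _ = _ := by rw [ENNReal.tsum_add, ENNReal.tsum_mul_right, P.tsum_coe, one_mul]

end PMF

namespace CondAlg

variable {N : ℕ} {R : Type} [Fintype R]
  (O : Set (Fin N) → PMF (Option (Fin N))) (a : CondAlg N R)

theorem ex_rep_succ (n : ℕ) (F : (Fin (n + 1) → R) → ℝ) :
    ((a.rep (n + 1)).run O).ex F =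
      (a.run O).ex fun r => ((a.rep n).run O).ex fun g => F (Fin.cons r g) := by
  simp only [rep, run_bind, PMF.ex_bind, run, PMF.ex_pure]

theorem ex_rep_sum (φ : R → ℝ) (h : (a.run O).ex φ = 0) (n : ℕ) :
    ((a.rep n).run O).ex (fun g => ∑ i, φ (g i)) = 0 := by
  induction n with
  | zero => simp [PMF.ex_const]
  | succ n ih =>
    simp only [ex_rep_succ, Fin.sum_univ_succ, Fin.cons_zero, Fin.cons_succ, PMF.ex_add,
      PMF.ex_const, ih, h, add_zero]

theorem ex_rep_sum_sq (φ : R → ℝ) (h : (a.run O).ex φ = 0) (n : ℕ) :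
    ((a.rep n).run O).ex (fun g => (∑ i, φ (g i)) ^ 2) =
      n * (a.run O).ex fun r => φ r ^ 2 := by
  induction n with
  | zero => simp [PMF.ex_const]
  | succ n ih =>
    simp only [ex_rep_succ, Fin.sum_univ_succ, Fin.cons_zero, Fin.cons_succ, add_sq, PMF.ex_add,
      PMF.ex_const, ih, PMF.ex_mul_left, ex_rep_sum O a φ h, mul_zero, add_zero]
    push_cast
    ring

/-- The fraction of successes in a sequence of trials. -/
noncomputable def frac {n : ℕ} (g : Fin n → Bool) : ℝ := (∑ i, if g i then (1 : ℝ) else 0) / n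

/-- Chebyshev's inequality for the fraction of successes in `n` independent trials. -/
theorem toOuterMeasure_rep_le (a : CondAlg N Bool) {h t : ℝ}
    (ha : (a.run O).ex (fun r => if r then 1 else 0) = h) (ht : 0 < t) {n : ℕ} (hn : 0 < n)
    (B : Set (Fin n → Bool)) (hB : ∀ g ∈ B, t ≤ |frac g - h|) :
    ((a.rep n).run O).toOuterMeasure B ≤ ENNReal.ofReal (h * (1 - h) / (n * t ^ 2)) := by
  have hn' : (0 : ℝ) < n := by exact_mod_cast hn
  set φ : Bool → ℝ := fun r => (if r then 1 else 0) + -h with hφ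
  have h0 : (a.run O).ex φ = 0 := by
    rw [hφ, PMF.ex_add, PMF.ex_const, ha]; ring
  have h2 : (a.run O).ex (fun r => φ r ^ 2) = h * (1 - h) := by
    have : (fun r => φ r ^ 2) = fun r : Bool => (1 - 2 * h) * (if r then (1 : ℝ) else 0) + h ^ 2 := by
      funext r
      cases r
      · simp [hφ]
      · simp [hφ]
        ring
    rw [this, PMF.ex_add, PMF.ex_mul_left, PMF.ex_const, ha]; ring
  have hs : ∀ g : Fin n → Bool, ∑ i, φ (g i) = n * (frac g - h) := fun g => by
    simp only [hφ, Finset.sum_add_distrib, frac]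
    field_simp
    simp
    ring
  refine (PMF.toOuterMeasure_le_ex _ B (fun g => (∑ i, φ (g i)) ^ 2 * (1 / (n * t) ^ 2))
    (fun g => by positivity) fun g hg => ?_).trans_eq ?_
  · rw [hs, mul_one_div, one_le_div (by positivity), ← sq_abs (_ * (_ - _)), abs_mul,
      abs_of_pos hn']
    have := hB g hg
    gcongr
  · rw [PMF.ex_mul_right, ex_rep_sum_sq O a φ h0, h2]
    congr 1
    field_simp

end CondAlg

/-! ### Two tests comparing an element with the rest of the domain -/

section

variable {N : ℕ} {μ : PMF (Fin N)} {O : Set (Fin N) → PMF (Option (Fin N))}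

/-- Conditional expectations as answered by the oracle. The set has positive mass because it
contains `x`, so the arbitrary behaviour on null sets plays no role. -/
theorem IsCondOracle.ex_query (hO : IsCondOracle μ O) {A : Finset (Fin N)} {x : Fin N}
    (hx : x ∈ A) (hμ : 0 < (μ x).toReal) (F : Option (Fin N) → ℝ) :
    (O A).ex F = (∑ y ∈ A, (μ y).toReal * F (some y)) / ∑ y ∈ A, (μ y).toReal := by
  classical
  have hs : x ∈ μ.support := fun h => by simp [h] at hμ
  have hA : ∑' y, (A : Set (Fin N)).indicator μ y = ∑ y ∈ A, μ y := by
    rw [tsum_fintype, Finset.sum_indicator_subset _ (Finset.subset_univ A)]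
  rw [hO A ⟨x, hx, hs⟩, ← PMF.bind_pure_comp, PMF.ex_bind]
  simp only [Function.comp, PMF.ex_pure]
  simp only [PMF.ex, PMF.filter_apply, hA, ENNReal.toReal_mul,
    ENNReal.toReal_inv]
  rw [ENNReal.toReal_sum fun a _ => μ.apply_ne_top a, Finset.sum_div,
    ← Finset.sum_subset (Finset.subset_univ A)]
  · refine Finset.sum_congr rfl fun y hy => ?_
    rw [Set.indicator_of_mem (by exact hy)]
    ring
  · intro y _ hy
    rw [Set.indicator_of_notMem (by exact hy)]
    simp

/-- Draw `y` from the distribution, then compare it with `x`; succeed if `x` wins. -/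
noncomputable def CondAlg.lightTrial (x : Fin N) : CondAlg N Bool :=
  .query (Finset.univ : Finset (Fin N)) fun y =>
    .query ({x, y.getD x} : Finset (Fin N)) fun z => .output (decide (z = some x))

/-- The success probability of `CondAlg.lightTrial`: the mass of the elements not much heavier
than `x`, in a smoothed sense. -/
noncomputable def lightMass (μ : PMF (Fin N)) (x : Fin N) : ℝ :=
  ∑ y, (μ y).toReal * if y = x then 1 else (μ x).toReal / ((μ x).toReal + (μ y).toReal)

theorem IsCondOracle.ex_lightTrial (hO : IsCondOracle μ O) {x : Fin N}
    (hμ : 0 < (μ x).toReal) :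
    ((CondAlg.lightTrial x).run O).ex (fun r => if r then 1 else 0) = lightMass μ x := by
  simp only [CondAlg.lightTrial, CondAlg.run, PMF.ex_bind, PMF.ex_pure]
  rw [hO.ex_query (Finset.mem_univ x) hμ, PMF.sum_toReal, div_one, lightMass]
  refine Finset.sum_congr rfl fun y _ => ?_
  congr 1
  rw [hO.ex_query (Finset.mem_insert_self x _) hμ]
  by_cases hy : y = x
  · simp [hy, hμ.ne']
  · rw [Option.getD_some, Finset.sum_pair (Ne.symm hy), Finset.sum_pair (Ne.symm hy)]
    simp [hy]

theorem lightMass_le_one (μ : PMF (Fin N)) (x : Fin N) : lightMass μ x ≤ 1 := by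
  rw [← μ.sum_toReal]
  refine Finset.sum_le_sum fun y _ => mul_le_of_le_one_right ENNReal.toReal_nonneg ?_
  split_ifs
  · exact le_rfl
  · exact div_le_one_of_le₀ (le_add_of_nonneg_right ENNReal.toReal_nonneg) (by positivity)

theorem half_sum_le_lightMass {x : Fin N} (hμ : 0 < (μ x).toReal) :
    (∑ y with (μ y).toReal ≤ (μ x).toReal, (μ y).toReal) / 2 ≤ lightMass μ x := by
  rw [Finset.sum_filter, Finset.sum_div]
  refine Finset.sum_le_sum fun y _ => ?_
  have h0 : 0 ≤ (μ y).toReal := ENNReal.toReal_nonneg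
  split_ifs with h1 h2 h2
  · linarith
  · rw [mul_div_assoc', le_div_iff₀ (by positivity)]
    nlinarith
  · linarith
  · rw [zero_div]
    positivity

/-- Only a small part of the mass lies on elements below a small quantile. -/
theorem sum_lightMass_lt_le (μ : PMF (Fin N)) {α : ℝ} (hα : 0 ≤ α) :
    ∑ x with 0 < (μ x).toReal ∧ lightMass μ x < α / 2, (μ x).toReal ≤ α := by
  rcases (Finset.univ.filter fun x => 0 < (μ x).toReal ∧ lightMass μ x < α / 2).eq_empty_or_nonempty
    with h | h
  · rwa [h, Finset.sum_empty]
  -- all elements in question lie below the heaviest of them, whose quantile is at most `α`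
  · obtain ⟨x, hx, hmax⟩ := Finset.exists_max_image _ (fun x => (μ x).toReal) h
    have hx' := (Finset.mem_filter.1 hx).2
    have := half_sum_le_lightMass hx'.1
    refine (Finset.sum_le_sum_of_subset_of_nonneg (t := Finset.univ.filter fun y =>
      (μ y).toReal ≤ (μ x).toReal) (fun y hy => ?_)
      fun _ _ _ => ENNReal.toReal_nonneg).trans (by linarith [hx'.2])
    exact Finset.mem_filter.2 ⟨Finset.mem_univ y, hmax y hy⟩

/-- A random subset containing each element independently with probability `q`. -/
noncomputable def bernoulliSubset (N : ℕ) (q : unitInterval) : PMF (Finset (Fin N)) :=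
  PMF.ofFintype (fun A => ENNReal.ofReal ((q : ℝ) ^ A.card * (1 - q) ^ (N - A.card))) <| by
    have h1 : (0 : ℝ) ≤ 1 - q := sub_nonneg.2 q.2.2
    have h := Finset.sum_pow_mul_eq_add_pow (q : ℝ) (1 - q) (Finset.univ : Finset (Fin N))
    rw [Finset.powerset_univ, add_sub_cancel, one_pow, Finset.card_univ, Fintype.card_fin] at h
    rw [← ENNReal.ofReal_sum_of_nonneg fun A _ =>
      mul_nonneg (pow_nonneg q.2.1 _) (pow_nonneg h1 _), h, ENNReal.ofReal_one]

theorem bernoulliSubset_ex (q : unitInterval) (G : Finset (Fin N) → ℝ) :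
    (bernoulliSubset N q).ex G = ∑ A, (q : ℝ) ^ A.card * (1 - q) ^ (N - A.card) * G A := by
  have h1 : (0 : ℝ) ≤ 1 - q := sub_nonneg.2 q.2.2
  refine Finset.sum_congr rfl fun A _ => ?_
  rw [bernoulliSubset, PMF.ofFintype_apply, ENNReal.toReal_ofReal
    (mul_nonneg (pow_nonneg q.2.1 _) (pow_nonneg h1 _))]

/-- Membership of `y` is independent of the rest of the random subset. -/
theorem bernoulliSubset_ex_mem (q : unitInterval) (y : Fin N) (G : Finset (Fin N) → ℝ) :
    (bernoulliSubset N q).ex (fun A => if y ∈ A then G (A.erase y) else 0) =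
      q * (bernoulliSubset N q).ex fun A => G (A.erase y) := by
  have hu : (Finset.univ : Finset (Finset (Fin N))) =
      (insert y (Finset.univ.erase y)).powerset := by
    rw [Finset.insert_erase (Finset.mem_univ y), Finset.powerset_univ]
  rw [bernoulliSubset_ex, bernoulliSubset_ex, hu,
    Finset.sum_powerset_insert (Finset.notMem_erase y _),
    Finset.sum_powerset_insert (Finset.notMem_erase y _), ← Finset.sum_add_distrib,
    ← Finset.sum_add_distrib, Finset.mul_sum]
  refine Finset.sum_congr rfl fun B hB => ?_
  have hy : y ∉ B := fun h => Finset.notMem_erase y _ (Finset.mem_powerset.1 hB h)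
  have hc : B.card < N := by
    have := Finset.card_le_card (Finset.mem_powerset.1 hB)
    rw [Finset.card_erase_of_mem (Finset.mem_univ y), Finset.card_univ, Fintype.card_fin] at this
    have := y.pos
    omega
  obtain ⟨d, hd⟩ : ∃ d, N - B.card = d + 1 := ⟨N - B.card - 1, by omega⟩
  have hd' : N - (B.card + 1) = d := by omega
  simp only [hy, if_false, Finset.mem_insert_self, if_true, Finset.erase_insert hy,
    Finset.erase_eq_of_notMem hy, Finset.card_insert_of_notMem hy, hd, hd']
  ring

/-- Draw a random subset `A` of density `q`; succeed if it contains `x`, or if a sample conditioned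
on `A ∪ {x}` differs from `x`. -/
noncomputable def CondAlg.countTrial (q : unitInterval) (x : Fin N) : CondAlg N Bool :=
  .toss (bernoulliSubset N q) fun A =>
    if x ∈ A then .output true
    else .query (insert x A : Finset (Fin N)) fun z => .output (decide (z ≠ some x))

/-- The number of elements not much lighter than `x`, in a smoothed sense: each `y ≠ x` counts
with the probability that it beats `x` in a comparison. -/
noncomputable def heavyCount (μ : PMF (Fin N)) (x : Fin N) : ℝ :=
  ∑ y, if y = x then 1 else (μ y).toReal / ((μ x).toReal + (μ y).toReal)

/-- The identity behind the estimator: the mass of `x` is `lightMass` divided by `heavyCount`. -/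
theorem mul_heavyCount (μ : PMF (Fin N)) (x : Fin N) :
    (μ x).toReal * heavyCount μ x = lightMass μ x := by
  rw [heavyCount, lightMass, Finset.mul_sum]
  refine Finset.sum_congr rfl fun y _ => ?_
  split_ifs with h
  · rw [h]
  · ring

/-- The success probability of `CondAlg.countTrial` for a given random subset. -/
noncomputable def hitProb (μ : PMF (Fin N)) (x : Fin N) (A : Finset (Fin N)) : ℝ :=
  if x ∈ A then 1 else (∑ y ∈ A, (μ y).toReal) / ((μ x).toReal + ∑ y ∈ A, (μ y).toReal)

theorem IsCondOracle.ex_countTrial (hO : IsCondOracle μ O) {x : Fin N}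
    (hμ : 0 < (μ x).toReal) (q : unitInterval) :
    ((CondAlg.countTrial q x).run O).ex (fun r => if r then 1 else 0) =
      (bernoulliSubset N q).ex (hitProb μ x) := by
  simp only [CondAlg.countTrial, CondAlg.run, PMF.ex_bind]
  refine congrArg _ (funext fun A => ?_)
  by_cases hx : x ∈ A
  · simp [hx, hitProb, CondAlg.run, PMF.ex_pure]
  · simp only [hx, if_false, CondAlg.run, PMF.ex_bind, PMF.ex_pure, hitProb]
    rw [hO.ex_query (Finset.mem_insert_self x A) hμ, Finset.sum_insert hx, Finset.sum_insert hx]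
    congr 1
    simp only [ne_eq, not_true, decide_false, Bool.false_eq_true, if_false, mul_zero, zero_add]
    refine Finset.sum_congr rfl fun y hy => ?_
    have : y ≠ x := fun h : y = x => hx (h ▸ hy)
    simp [this]

/-- The hitting probability is subadditive in the elements of the random subset. -/
theorem hitProb_le {x : Fin N} (hμ : 0 < (μ x).toReal) (A : Finset (Fin N)) :
    hitProb μ x A ≤
      ∑ y ∈ A, if y = x then 1 else (μ y).toReal / ((μ x).toReal + (μ y).toReal) := by
  have h0 : ∀ y, 0 ≤ (μ y).toReal := fun y => ENNReal.toReal_nonneg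
  have h1 : ∀ y ∈ A, (0 : ℝ) ≤
      if y = x then 1 else (μ y).toReal / ((μ x).toReal + (μ y).toReal) := fun y _ => by
    have := h0 y
    split_ifs <;> positivity
  rw [hitProb]
  split_ifs with hx
  · simpa using Finset.single_le_sum h1 hx
  · rw [Finset.sum_div]
    refine Finset.sum_le_sum fun y hy => ?_
    rw [if_neg fun h : y = x => hx (h ▸ hy)]
    exact div_le_div_of_nonneg_left (h0 y) (by linarith [h0 y])
      (by linarith [Finset.single_le_sum (fun z _ => h0 z) hy])

/-- A converse to the subadditivity, with the chance that `x` beats the rest of the subset as the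
loss factor; it is a function of `A.erase y`, hence independent of the membership of `y`. -/
theorem sum_le_hitProb {x : Fin N} (hμ : 0 < (μ x).toReal) (A : Finset (Fin N)) :
    (∑ y ∈ A, (if y = x then 1 else (μ y).toReal / ((μ x).toReal + (μ y).toReal)) *
      (1 - hitProb μ x (A.erase y))) ≤ hitProb μ x A := by
  have h0 : ∀ y, 0 ≤ (μ y).toReal := fun y => ENNReal.toReal_nonneg
  by_cases hx : x ∈ A
  · have hS := Finset.sum_nonneg (s := A.erase x) fun z _ => h0 z
    rw [hitProb, if_pos hx, Finset.sum_eq_single_of_mem x hx]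
    · rw [if_pos rfl, one_mul, hitProb, if_neg (Finset.notMem_erase x A)]
      have : 0 ≤ (∑ y ∈ A.erase x, (μ y).toReal) /
        ((μ x).toReal + ∑ y ∈ A.erase x, (μ y).toReal) := by positivity
      linarith
    · intro y _ hy
      rw [hitProb, if_pos (Finset.mem_erase.2 ⟨hy.symm, hx⟩), sub_self, mul_zero]
  · rw [hitProb, if_neg hx, Finset.sum_div]
    refine Finset.sum_le_sum fun y hy => ?_
    have hsum := Finset.add_sum_erase A (fun z => (μ z).toReal) hy
    have hS := Finset.sum_nonneg (s := A.erase y) fun z _ => h0 z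
    rw [if_neg fun h : y = x => hx (h ▸ hy), hitProb, if_neg fun h => hx (Finset.mem_of_mem_erase h),
      ← hsum]
    have hy0 := h0 y
    set p := (μ x).toReal
    set m := (μ y).toReal
    set u := ∑ z ∈ A.erase y, (μ z).toReal
    rw [one_sub_div (by positivity), add_sub_cancel_right, div_mul_div_comm,
      div_le_div_iff₀ (by positivity) (by positivity)]
    nlinarith [mul_nonneg hy0 (mul_nonneg hy0 hS)]

theorem hitProb_erase_le {x : Fin N} (hμ : 0 < (μ x).toReal) (A : Finset (Fin N)) (y : Fin N) :
    hitProb μ x (A.erase y) ≤ hitProb μ x A := by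
  have h0 : ∀ y, 0 ≤ (μ y).toReal := fun y => ENNReal.toReal_nonneg
  have hS := Finset.sum_nonneg (s := A.erase y) fun z _ => h0 z
  have hle := Finset.sum_le_sum_of_subset_of_nonneg (Finset.erase_subset y A)
    fun z _ _ => h0 z
  rw [hitProb, hitProb]
  by_cases hx : x ∈ A
  · rw [if_pos hx]
    split_ifs
    · exact le_rfl
    · exact div_le_one_of_le₀ (by linarith) (by linarith)
  · rw [if_neg hx, if_neg fun h => hx (Finset.mem_of_mem_erase h),
      div_le_div_iff₀ (by linarith) (by linarith)]
    nlinarith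

theorem PMF.ex_sum_mem (P : PMF (Finset (Fin N))) (f : Finset (Fin N) → Fin N → ℝ) :
    (P.ex fun A => ∑ y ∈ A, f A y) = ∑ y, P.ex fun A => if y ∈ A then f A y else 0 := by
  rw [← PMF.ex_sum]
  simp

/-- Together with `le_ex_hitProb`: for `a = q * heavyCount μ x`, the success probability of
`CondAlg.countTrial` lies between `a / (1 + a)` and `a`. -/
theorem ex_hitProb_le {x : Fin N} (hμ : 0 < (μ x).toReal) (q : unitInterval) :
    (bernoulliSubset N q).ex (hitProb μ x) ≤ q * heavyCount μ x := by
  refine (PMF.ex_mono _ (hitProb_le hμ)).trans_eq ?_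
  rw [heavyCount, Finset.mul_sum, PMF.ex_sum_mem]
  refine Finset.sum_congr rfl fun y _ => ?_
  rw [bernoulliSubset_ex_mem q y fun _ => _, PMF.ex_const]

/-- Obtained by taking expectations in `sum_le_hitProb`, without any concentration argument. -/
theorem le_ex_hitProb {x : Fin N} (hμ : 0 < (μ x).toReal) (q : unitInterval) :
    q * heavyCount μ x * (1 - (bernoulliSubset N q).ex (hitProb μ x)) ≤
      (bernoulliSubset N q).ex (hitProb μ x) := by
  refine le_trans ?_ (PMF.ex_mono _ (sum_le_hitProb hμ))
  rw [PMF.ex_sum_mem, heavyCount, Finset.mul_sum, Finset.sum_mul]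
  refine Finset.sum_le_sum fun y _ => ?_
  rw [bernoulliSubset_ex_mem q y fun B =>
    (if y = x then 1 else (μ y).toReal / ((μ x).toReal + (μ y).toReal)) * (1 - hitProb μ x B),
    PMF.ex_mul_left, ← mul_assoc]
  refine mul_le_mul_of_nonneg_left ?_ (mul_nonneg q.2.1 ?_)
  · have h := PMF.ex_mono (bernoulliSubset N q) fun A => hitProb_erase_le hμ A y
    simp only [sub_eq_add_neg, PMF.ex_add, PMF.ex_const, ← neg_one_mul (hitProb _ _ _),
      PMF.ex_mul_left]
    linarith
  · split_ifs <;> positivity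

end

/-! ### Noisy binary search -/

section

variable {N : ℕ} {μ : PMF (Fin N)} {O : Set (Fin N) → PMF (Option (Fin N))}

/-- Binary search in the interval from `lo` to `lo + 2 ^ d`, where the (randomized) answer `true`
of the test `T m` moves the upper end to `m`, and `false` the lower end. -/
noncomputable def CondAlg.search (T : ℕ → CondAlg N Bool) : (d lo : ℕ) → CondAlg N ℕ
  | 0, lo => .output lo
  | d + 1, lo => (T (lo + 2 ^ d)).bind fun t =>
      if t then search T d lo else search T d (lo + 2 ^ d)

theorem CondAlg.UsesAtMost.search {T : ℕ → CondAlg N Bool} {q : ℕ}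
    (hT : ∀ m, (T m).UsesAtMost q) (d lo : ℕ) : (search T d lo).UsesAtMost (d * q) := by
  induction d generalizing lo with
  | zero => trivial
  | succ d ih =>
    rw [Nat.succ_mul, Nat.add_comm (d * q)]
    refine (hT _).bind fun t => ?_
    cases t
    · exact ih _
    · exact ih _

/-- If `Low` and `High` say which positions are acceptable as lower and upper ends, the search
ends at an acceptable pair of neighbours unless some test moves an end to an unacceptable
position. Each position is tested at most once, so the error probabilities of the tests add up. -/
theorem CondAlg.search_error {T : ℕ → CondAlg N Bool} {Low High : ℕ → Prop} {e : ℕ → ENNReal}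
    (hT : ∀ m, ((T m).run O).toOuterMeasure {t | if t then ¬ High m else ¬ Low m} ≤ e m)
    (d lo : ℕ) (hlo : Low lo) (hhi : High (lo + 2 ^ d)) :
    ((search T d lo).run O).toOuterMeasure
        {m | ¬ (lo ≤ m ∧ m < lo + 2 ^ d ∧ Low m ∧ High (m + 1))} ≤
      ∑ m ∈ Finset.Ioo lo (lo + 2 ^ d), e m := by
  induction d generalizing lo with
  | zero =>
    rw [search, run, PMF.toOuterMeasure_pure_apply, if_neg]
    · exact zero_le
    · simpa using ⟨hlo, by simpa using hhi⟩
  | succ d ih =>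
    have hp : 0 < 2 ^ d := by positivity
    have hp2 : 2 ^ (d + 1) = 2 ^ d + 2 ^ d := by ring
    have hsub : ∀ s ⊆ Finset.Ioo lo (lo + 2 ^ (d + 1)), lo + 2 ^ d ∉ s →
        e (lo + 2 ^ d) + ∑ m ∈ s, e m ≤ ∑ m ∈ Finset.Ioo lo (lo + 2 ^ (d + 1)), e m := by
      intro s hs hm
      rw [← Finset.sum_insert hm]
      refine Finset.sum_le_sum_of_subset (Finset.insert_subset ?_ hs)
      rw [Finset.mem_Ioo]
      omega
    have key : ∀ t, t ∉ {t | if t = true then ¬ High (lo + 2 ^ d) else ¬ Low (lo + 2 ^ d)} →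
        ((if t = true then search T d lo else search T d (lo + 2 ^ d)).run O).toOuterMeasure
          {m | ¬ (lo ≤ m ∧ m < lo + 2 ^ (d + 1) ∧ Low m ∧ High (m + 1))} ≤
        max (∑ m ∈ Finset.Ioo lo (lo + 2 ^ d), e m)
          (∑ m ∈ Finset.Ioo (lo + 2 ^ d) (lo + 2 ^ (d + 1)), e m) := by
      intro t ht
      cases t
      · have ht' : Low (lo + 2 ^ d) := by simpa using ht
        have h := ih (lo + 2 ^ d) ht' (by rwa [Nat.add_assoc, ← hp2])
        rw [Nat.add_assoc, ← hp2] at h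
        refine le_max_of_le_right (le_trans (MeasureTheory.measure_mono fun m hm => ?_) h)
        simp only [Set.mem_ofPred_eq] at hm ⊢
        exact fun h => hm ⟨by omega, h.2⟩
      · have ht' : High (lo + 2 ^ d) := by simpa using ht
        refine le_max_of_le_left (le_trans (MeasureTheory.measure_mono fun m hm => ?_)
          (ih lo hlo ht'))
        simp only [Set.mem_ofPred_eq] at hm ⊢
        exact fun h => hm ⟨h.1, by omega, h.2.2⟩
    rw [search, run_bind]
    refine (PMF.toOuterMeasure_bind_le _ _ _ _ _ key).trans
      ((add_le_add_left (hT (lo + 2 ^ d)) _).trans ?_)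
    rcases max_choice (∑ m ∈ Finset.Ioo lo (lo + 2 ^ d), e m)
      (∑ m ∈ Finset.Ioo (lo + 2 ^ d) (lo + 2 ^ (d + 1)), e m) with h | h
    · rw [h]
      refine hsub _ (Finset.Ioo_subset_Ioo_right (by omega)) (by simp)
    · rw [h]
      refine hsub _ (Finset.Ioo_subset_Ioo_left (by omega)) (by simp)

/-- The squared inverse distances from a real point to the integers, those within distance one
excluded, have a bounded sum. -/
theorem sum_inv_sq_le (β : ℝ) (n : ℕ) :
    ∑ m ∈ Finset.range n, (if |(m : ℝ) - β| ≤ 1 then 0 else 1 / ((m : ℝ) - β) ^ 2) ≤ 4 := by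
  -- a bounded potential whose increments dominate the summands, from `1/t² ≤ 1/(t-½) - 1/(t+½)`
  set Φ : ℝ → ℝ := fun t =>
    if t < 0 then 1 / (1 / 2 - t) else if t ≤ 1 then 2 else 4 - 1 / (t - 1 / 2) with hΦ
  have hsq : ∀ t : ℝ, 1 < t → 1 / t ^ 2 ≤ 1 / (t - 1 / 2) - 1 / (t + 1 / 2) := fun t ht => by
    rw [div_sub_div _ _ (by linarith) (by linarith), div_le_div_iff₀ (by positivity)
      (mul_pos (by linarith) (by linarith))]
    nlinarith
  have hstep : ∀ t : ℝ, Φ t + (if |t| ≤ 1 then 0 else 1 / t ^ 2) ≤ Φ (t + 1) := by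
    intro t
    rcases lt_or_ge t (-1) with h1 | h1
    · have h := hsq (-t) (by linarith)
      simp only [hΦ, if_pos (show t < 0 by linarith), if_pos (show t + 1 < 0 by linarith)]
      rw [if_neg (by rw [abs_of_neg (by linarith)]; linarith)]
      rw [neg_sq] at h
      have e1 : -t - 1 / 2 = 1 / 2 - (t + 1) := by ring
      have e2 : -t + 1 / 2 = 1 / 2 - t := by ring
      rw [e1, e2] at h
      linarith
    rcases le_or_gt t 1 with h2 | h2
    · rw [if_pos (abs_le.2 ⟨h1, h2⟩), add_zero]
      simp only [hΦ]
      have ht1 : ¬ t + 1 < 0 := by linarith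
      rw [if_neg ht1]
      rcases lt_or_ge t 0 with h3 | h3
      · rw [if_pos h3, if_pos (by linarith), div_le_iff₀ (by linarith)]
        linarith
      · rw [if_neg (by linarith), if_pos h2]
        split_ifs
        · exact le_rfl
        · have : 1 / (t + 1 - 1 / 2) ≤ 2 := by
            rw [div_le_iff₀ (by linarith)]
            linarith
          linarith
    · have h := hsq t h2
      simp only [hΦ]
      rw [if_neg (by linarith), if_neg (by linarith),
        if_neg (by rw [abs_of_pos (by linarith)]; linarith),
        if_neg (by linarith), if_neg (by linarith)]
      have e1 : t + 1 - 1 / 2 = t + 1 / 2 := by ring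
      rw [e1]
      linarith
  have hnn : ∀ t, 0 ≤ Φ t := fun t => by
    simp only [hΦ]
    split_ifs with h1 h2
    · exact one_div_nonneg.2 (by linarith)
    · norm_num
    · have : 1 / (t - 1 / 2) ≤ 2 := by
        rw [div_le_iff₀ (by linarith)]
        linarith
      linarith
  have hle : ∀ t, Φ t ≤ 4 := fun t => by
    simp only [hΦ]
    split_ifs with h1 h2
    · rw [div_le_iff₀ (by linarith)]
      linarith
    · norm_num
    · have : 0 ≤ 1 / (t - 1 / 2) := one_div_nonneg.2 (by linarith)
      linarith
  refine le_trans ?_ (hle (n - β))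
  induction n with
  | zero => simpa using hnn _
  | succ n ih =>
    rw [Finset.sum_range_succ]
    have := hstep (n - β)
    push_cast
    rw [show (n : ℝ) + 1 - β = n - β + 1 by ring]
    linarith

/-! ### Estimating the mass of a single element -/

/-- Chebyshev error terms at ratio `r` decay like the squared inverse distance on the logarithmic
scale. -/
theorem div_sub_one_sq_le {r : ℝ} (hr : 0 < r) (hr1 : Real.log r ≠ 0) :
    r / (r - 1) ^ 2 ≤ 4 / Real.log r ^ 2 := by
  have key : ∀ r : ℝ, 1 < r → r / (r - 1) ^ 2 ≤ 4 / Real.log r ^ 2 := fun r hr => by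
    have hs : 1 < √r := by rw [Real.lt_sqrt zero_le_one]; linarith
    have hl := Real.log_le_sub_one_of_pos (show 0 < √r by linarith)
    rw [Real.log_sqrt (by linarith)] at hl
    have hlp := Real.log_pos hr
    have hr2 : √r ^ 2 = r := Real.sq_sqrt (by linarith)
    rw [div_le_div_iff₀ (by nlinarith) (by positivity)]
    have h1 : Real.log r ^ 2 ≤ (2 * (√r - 1)) ^ 2 := by gcongr; linarith
    have h2 : r * (√r - 1) ^ 2 ≤ (r - 1) ^ 2 := by
      have e : (√r * (√r - 1)) ^ 2 ≤ (√r ^ 2 - 1) ^ 2 :=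
        pow_le_pow_left₀ (by nlinarith) (by nlinarith) 2
      rw [mul_pow, hr2] at e
      exact e
    nlinarith
  rcases lt_trichotomy r 1 with h | h | h
  · have := key r⁻¹ ((one_lt_inv₀ hr).2 h)
    rw [Real.log_inv, neg_sq] at this
    refine le_of_eq_of_le ?_ this
    have hr2 : r - 1 ≠ 0 := by linarith
    have hr3 : 1 - r ≠ 0 := by linarith
    rw [show r⁻¹ - 1 = (1 - r) / r by field_simp]
    field_simp
    ring
  · simp [h] at hr1
  · exact key r h

/-- The test used in the search: the empirical success rate of `CondAlg.countTrial` exceeds `θ`. -/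
noncomputable def CondAlg.countTest (q : unitInterval) (x : Fin N) (θ : ℝ) (n : ℕ) :
    CondAlg N Bool :=
  ((countTrial q x).rep n).bind fun g => .output (decide (θ < frac g))

/-- The test rarely answers `true` at a density that is too small by a factor `r < 1`. -/
theorem IsCondOracle.countTest_true_le (hO : IsCondOracle μ O) {x : Fin N}
    (hμ : 0 < (μ x).toReal) {q : unitInterval} {θ r : ℝ} (hθ : 0 < θ)
    (hr : q * heavyCount μ x = θ * r) (hr0 : 0 < r) (hr1 : r < 1) {n : ℕ} (hn : 0 < n) :
    ((CondAlg.countTest q x θ n).run O).toOuterMeasure {true} ≤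
      ENNReal.ofReal (16 / (n * θ * Real.log r ^ 2)) := by
  have hn' : (0 : ℝ) < n := by exact_mod_cast hn
  have h1 := ex_hitProb_le hμ q
  rw [hr] at h1
  have hlog : Real.log r ≠ 0 := (Real.log_neg hr0 hr1).ne
  have h0 : 0 ≤ (bernoulliSubset N q).ex (hitProb μ x) := by
    rw [← PMF.ex_const (bernoulliSubset N q) 0]
    refine PMF.ex_mono _ fun A => ?_
    have := Finset.sum_nonneg (s := A) fun z _ => (ENNReal.toReal_nonneg : 0 ≤ (μ z).toReal)
    rw [hitProb]
    split_ifs <;> positivity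
  have hd := div_sub_one_sq_le hr0 hlog
  have hpos : 0 < Real.log r ^ 2 := by positivity
  rw [CondAlg.countTest, CondAlg.run_bind]
  refine (PMF.toOuterMeasure_bind_le _ _ _ {g | θ < CondAlg.frac g} 0 fun g hg => ?_).trans ?_
  · rw [CondAlg.run, PMF.toOuterMeasure_pure_apply, if_neg (by simpa using hg)]
  rw [add_zero]
  refine (CondAlg.toOuterMeasure_rep_le O _ (hO.ex_countTrial hμ q) (t := θ * (1 - r))
    (mul_pos hθ (by linarith)) hn _ fun g hg => ?_).trans (ENNReal.ofReal_le_ofReal ?_)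
  · have hg' : θ < CondAlg.frac g := hg
    exact le_trans (by linarith) (le_abs_self _)
  set h := (bernoulliSubset N q).ex (hitProb μ x)
  calc h * (1 - h) / (n * (θ * (1 - r)) ^ 2) ≤ θ * r / (n * (θ * (1 - r)) ^ 2) := by
        have : h * (1 - h) ≤ θ * r := by nlinarith
        gcongr
    _ = 1 / (n * θ) * (r / (r - 1) ^ 2) := by
        have : (1 - r) ≠ 0 := by linarith
        have : (r - 1) ≠ 0 := by linarith
        field_simp
        ring
    _ ≤ 1 / (n * θ) * (4 / Real.log r ^ 2) := by gcongr
    _ ≤ 16 / (n * θ * Real.log r ^ 2) := by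
        rw [div_mul_div_comm]
        gcongr
        norm_num

/-- The test rarely answers `false` at a density that is too large by a factor `r`; the margin
`4 * θ` makes up for the saturation of the success probability. -/
theorem IsCondOracle.countTest_false_le (hO : IsCondOracle μ O) {x : Fin N}
    (hμ : 0 < (μ x).toReal) {q : unitInterval} {θ r : ℝ} (hθ : 0 < θ) (hθ1 : θ ≤ 1 / 4)
    (hr : q * heavyCount μ x = θ * r) (hr1 : 1 + 4 * θ ≤ r) {n : ℕ} (hn : 0 < n) :
    ((CondAlg.countTest q x θ n).run O).toOuterMeasure {false} ≤
      ENNReal.ofReal (16 / (n * θ * Real.log r ^ 2)) := by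
  have hn' : (0 : ℝ) < n := by exact_mod_cast hn
  have h1 := le_ex_hitProb hμ q
  rw [hr] at h1
  have hr0 : 1 < r := by linarith
  have hlog : Real.log r ≠ 0 := (Real.log_pos hr0).ne'
  have h0 : (bernoulliSubset N q).ex (hitProb μ x) ≤ 1 := by
    rw [← PMF.ex_const (bernoulliSubset N q) 1]
    refine PMF.ex_mono _ fun A => ?_
    have := Finset.sum_nonneg (s := A) fun z _ => (ENNReal.toReal_nonneg : 0 ≤ (μ z).toReal)
    rw [hitProb]
    split_ifs
    · exact le_rfl
    · exact div_le_one_of_le₀ (by linarith) (by linarith)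
  have hd := div_sub_one_sq_le (by linarith) hlog
  have hpos : 0 < Real.log r ^ 2 := by positivity
  -- the success probability is at least `l = θ r / (1 + θ r)`, which is well above `θ`
  set h := (bernoulliSubset N q).ex (hitProb μ x) with hh
  have hθr : 0 < θ * r := by positivity
  set l := θ * r / (1 + θ * r) with hl
  have hlh : l ≤ h := by
    rw [hl, div_le_iff₀ (by positivity)]
    linarith
  have hl1 : 1 - l = 1 / (1 + θ * r) := by
    rw [hl]
    field_simp
    ring
  have hlθ : θ * ((r - 1) / 2) / (1 + θ * r) ≤ l - θ := by
    rw [hl, div_le_iff₀ (by positivity), sub_mul, div_mul_cancel₀ _ (by positivity)]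
    nlinarith [mul_nonneg hθ.le (mul_nonneg (show 0 ≤ 1 - 2 * θ by linarith)
      (show 0 ≤ r - 1 - 4 * θ by linarith)), mul_nonneg (mul_nonneg hθ.le hθ.le)
      (show 0 ≤ 1 - 4 * θ by linarith)]
  have hpos' : 0 < θ * ((r - 1) / 2) / (1 + θ * r) := by
    have : 0 < r - 1 := by linarith
    positivity
  have hhθ : 0 < h - θ := by linarith
  rw [CondAlg.countTest, CondAlg.run_bind]
  refine (PMF.toOuterMeasure_bind_le _ _ _ {g | ¬ θ < CondAlg.frac g} 0 fun g hg => ?_).trans ?_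
  · rw [CondAlg.run, PMF.toOuterMeasure_pure_apply, if_neg (by simpa using hg)]
  rw [add_zero]
  refine (CondAlg.toOuterMeasure_rep_le O _ (hO.ex_countTrial hμ q) (t := h - θ)
    hhθ hn _ fun g hg => ?_).trans (ENNReal.ofReal_le_ofReal ?_)
  · have hg' : ¬ θ < CondAlg.frac g := hg
    exact le_trans (by linarith) (neg_le_abs _)
  have hl0 : 0 < l := by positivity
  have e1 : h * (l - θ) ≤ l * (h - θ) := by nlinarith
  have e2 : (1 - h) * (l - θ) ≤ (1 - l) * (h - θ) := by nlinarith
  have e3 : h * (1 - h) * (l - θ) ^ 2 ≤ l * (1 - l) * (h - θ) ^ 2 := by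
    have := mul_le_mul e1 e2 (mul_nonneg (by linarith) (by linarith))
      (mul_nonneg hl0.le hhθ.le)
    nlinarith
  have e4 : h * (1 - h) / (h - θ) ^ 2 ≤ 4 * r / (θ * (r - 1) ^ 2) := by
    calc h * (1 - h) / (h - θ) ^ 2 ≤ l * (1 - l) / (l - θ) ^ 2 := by
          rw [div_le_div_iff₀ (by positivity) (pow_pos (by linarith) 2)]
          exact e3
      _ ≤ l * (1 - l) / (θ * ((r - 1) / 2) / (1 + θ * r)) ^ 2 := by
          have : 0 ≤ l * (1 - l) := by rw [hl1]; positivity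
          gcongr
      _ = 4 * r / (θ * (r - 1) ^ 2) := by
          have : (r - 1) ≠ 0 := by linarith
          rw [hl1, hl]
          field_simp
          ring
  calc h * (1 - h) / (n * (h - θ) ^ 2) = 1 / n * (h * (1 - h) / (h - θ) ^ 2) := by
        field_simp
    _ ≤ 1 / n * (4 * r / (θ * (r - 1) ^ 2)) := by gcongr
    _ = 4 / (n * θ) * (r / (r - 1) ^ 2) := by field_simp
    _ ≤ 4 / (n * θ) * (4 / Real.log r ^ 2) := by gcongr
    _ = 16 / (n * θ * Real.log r ^ 2) := by
        field_simp
        norm_num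

end

section

variable {N : ℕ} {μ : PMF (Fin N)} {O : Set (Fin N) → PMF (Option (Fin N))}

/-- The randomized bucket of `x`: the position of an estimate of its mass in the geometric grid
`exp (γ * (m - 2 ^ D))`, `m < 2 ^ D`. Once `lightMass μ x` is known, `m` is the position where the
success probability of `CondAlg.countTrial` with density `γ / 4 * exp (γ * (m - 2 ^ D)) / lightMass`
crosses `γ / 4`. -/
noncomputable def CondAlg.bucketOf (γ : ℝ) (n D : ℕ) (x : Fin N) : CondAlg N (Fin (2 ^ D)) :=
  ((lightTrial x).rep n).bind fun g =>
    (search (fun m => countTest (Set.projIcc 0 1 zero_le_one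
      (γ / 4 * Real.exp (γ * (m - 2 ^ D)) / frac g)) x (γ / 4) n) D 0).bind fun m =>
        .output (Fin.ofNat (2 ^ D) m)

theorem CondAlg.usesAtMost_countTest (q : unitInterval) (x : Fin N) (θ : ℝ) (n : ℕ) :
    (countTest q x θ n).UsesAtMost n := by
  have h : (countTrial q x).UsesAtMost 1 := fun A => by
    by_cases hx : x ∈ A
    · simp only [hx, if_true]
      trivial
    · simp only [hx, if_false]
      exact fun z => trivial
  have h' := h.rep n
  rw [mul_one] at h'
  exact h'.bind (q' := 0) fun g => trivial

theorem CondAlg.usesAtMost_bucketOf (γ : ℝ) (n D : ℕ) (x : Fin N) :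
    (bucketOf γ n D x).UsesAtMost (n * 2 + D * n) := by
  have h : (lightTrial x).UsesAtMost 2 := fun y z => trivial
  refine (h.rep n).bind fun g => ?_
  refine UsesAtMost.bind (q' := 0) (UsesAtMost.search (fun m => ?_) D 0) fun m => trivial
  exact usesAtMost_countTest _ x _ n

/-- The grid point number `m` agrees with the mass `p` up to a factor `exp (± 3γ)`. -/
def NearBucket (γ : ℝ) (D : ℕ) (p : ℝ) (m : ℕ) : Prop :=
  |Real.log p - γ * (m - 2 ^ D)| ≤ 3 * γ

/-- The search for the bucket, given an approximate value `s` of `lightMass μ x`. -/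
theorem IsCondOracle.search_countTest_error (hO : IsCondOracle μ O) {x : Fin N}
    (hμ : 0 < (μ x).toReal) {γ : ℝ} (hγ : 0 < γ) (hγ1 : γ ≤ 1) {n : ℕ} (hn : 0 < n) {D : ℕ}
    (hD : Real.exp (-(γ * 2 ^ D)) ≤ (μ x).toReal) {s : ℝ} (hs : γ / 4 ≤ s)
    (hs1 : |Real.log s - Real.log (lightMass μ x)| ≤ γ) (hS : 0 < lightMass μ x) :
    ((CondAlg.search (fun m => CondAlg.countTest (Set.projIcc 0 1 zero_le_one
      (γ / 4 * Real.exp (γ * (m - 2 ^ D)) / s)) x (γ / 4) n) D 0).run O).toOuterMeasure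
        {m | ¬ (m < 2 ^ D ∧ NearBucket γ D (μ x).toReal m)} ≤
      ENNReal.ofReal (256 / (n * γ ^ 3)) := by
  have hn' : (0 : ℝ) < n := by exact_mod_cast hn
  have hs0 : 0 < s := by linarith
  have hp1 : (μ x).toReal ≤ 1 := by
    rw [← ENNReal.toReal_one]
    exact ENNReal.toReal_mono ENNReal.one_ne_top (μ.coe_le_one x)
  set p := (μ x).toReal with hp
  set S := lightMass μ x with hSdef
  have hSp : p * heavyCount μ x = S := mul_heavyCount μ x
  -- the real position in the grid where the density makes the expected count exactly `γ / 4`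
  set δ := Real.log p + Real.log s - Real.log S with hδ
  set β : ℝ := 2 ^ D + δ / γ with hβ
  have hβγ : ∀ m : ℕ, γ * (m - β) = γ * (m - 2 ^ D) - δ := fun m => by
    rw [hβ]
    field_simp
    ring
  have hexp : ∀ m : ℕ, Real.exp (γ * (m - β)) = Real.exp (γ * (m - 2 ^ D)) * S / (p * s) := by
    intro m
    rw [hβγ, Real.exp_sub, hδ, Real.exp_sub, Real.exp_add, Real.exp_log hμ, Real.exp_log hs0,
      Real.exp_log hS]
    field_simp
  have hs2 := abs_le.1 hs1
  have hlogp : Real.log p ≤ 0 := Real.log_nonpos hμ.le hp1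
  have hlogp2 : -(γ * 2 ^ D) ≤ Real.log p := (Real.le_log_iff_exp_le hμ).2 hD
  -- beyond the grid the density would be clipped at one, but no test is made there
  set e : ℕ → ENNReal := fun m =>
    if 2 ^ D < m then ⊤ else ENNReal.ofReal (64 / (n * γ ^ 3) *
      (if |(m : ℝ) - β| ≤ 1 then 0 else 1 / ((m : ℝ) - β) ^ 2)) with he
  have hT : ∀ m, ((CondAlg.countTest (Set.projIcc 0 1 zero_le_one
      (γ / 4 * Real.exp (γ * ((m : ℕ) - 2 ^ D)) / s)) x (γ / 4) n).run O).toOuterMeasure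
        {t | if t then ¬ (-1 ≤ (m : ℝ) - β) else ¬ ((m : ℝ) - β ≤ 1)} ≤ e m := by
    intro m
    simp only [he]
    by_cases hm : 2 ^ D < m
    · rw [if_pos hm]
      exact le_top
    rw [if_neg hm]
    by_cases hmβ : |(m : ℝ) - β| ≤ 1
    · rw [if_pos hmβ, mul_zero, ENNReal.ofReal_zero]
      have h2 := abs_le.1 hmβ
      rw [show {t : Bool | if t = true then ¬ (-1 ≤ (m : ℝ) - β) else ¬ ((m : ℝ) - β ≤ 1)} = ∅ by
        ext t
        cases t <;> simp [h2.1, h2.2]]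
      simp
    rw [if_neg hmβ]
    have hm' : (m : ℝ) ≤ 2 ^ D := by exact_mod_cast not_lt.1 hm
    have hv : Real.exp (γ * (m - 2 ^ D)) ≤ 1 :=
      Real.exp_le_one_iff.2 (mul_nonpos_of_nonneg_of_nonpos hγ.le (by linarith))
    have hv0 := Real.exp_pos (γ * (m - 2 ^ D))
    have hq1 : γ / 4 * Real.exp (γ * (m - 2 ^ D)) / s ∈ Set.Icc (0 : ℝ) 1 := by
      refine ⟨by positivity, div_le_one_of_le₀ ?_ hs0.le⟩
      nlinarith
    have hqM : γ / 4 * Real.exp (γ * (m - 2 ^ D)) / s * heavyCount μ x =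
        γ / 4 * Real.exp (γ * (m - β)) := by
      rw [hexp, ← hSp]
      field_simp
    have herr : 16 / (n * (γ / 4) * Real.log (Real.exp (γ * (m - β))) ^ 2) =
        64 / (n * γ ^ 3) * (1 / ((m : ℝ) - β) ^ 2) := by
      have : (m : ℝ) - β ≠ 0 := fun h => hmβ (by rw [h, abs_zero]; norm_num)
      rw [Real.log_exp]
      field_simp
      norm_num
    rw [← herr, Set.projIcc_of_mem zero_le_one hq1]
    rcases lt_or_ge ((m : ℝ) - β) (-1) with h | h
    · refine le_trans (MeasureTheory.measure_mono fun t ht => ?_) (hO.countTest_true_le hμ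
        (q := ⟨_, hq1⟩) (by positivity) hqM (Real.exp_pos _)
        (Real.exp_lt_one_iff.2 (by nlinarith)) hn)
      cases t
      · have : ¬ ((m : ℝ) - β ≤ 1) := by simpa using ht
        exact absurd (by linarith) this
      · rfl
    · have h1 : 1 < (m : ℝ) - β := by
        by_contra h1
        exact hmβ (abs_le.2 ⟨h, not_lt.1 h1⟩)
      refine le_trans (MeasureTheory.measure_mono fun t ht => ?_) (hO.countTest_false_le hμ
        (q := ⟨_, hq1⟩) (by positivity) (by linarith) hqM ?_ hn)
      · cases t
        · rfl
        · have : ¬ (-1 ≤ (m : ℝ) - β) := by simpa using ht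
          exact absurd h this
      · have := Real.add_one_le_exp (γ * (m - β))
        nlinarith
  have hmain := CondAlg.search_error (O := O) (Low := fun m => (m : ℝ) - β ≤ 1)
    (High := fun m => -1 ≤ (m : ℝ) - β) hT D 0 (by
      simp only [hβ, hδ, Nat.cast_zero]
      have : (-(2 : ℝ) ^ D) ≤ 1 + δ / γ := by
        rw [← sub_le_iff_le_add', le_div_iff₀ hγ]
        nlinarith
      linarith) (by
      simp only [hβ, hδ, zero_add]
      push_cast
      have : δ / γ ≤ 1 := by
        rw [div_le_iff₀ hγ]
        linarith
      linarith)
  refine le_trans (MeasureTheory.measure_mono fun m hm => ?_) (hmain.trans ?_)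
  · simp only [Set.mem_ofPred_eq] at hm ⊢
    rintro ⟨-, h2, h3, h4⟩
    refine hm ⟨by simpa using h2, ?_⟩
    push_cast at h4
    have e1 := hβγ m
    have h5 : γ * (m - β) ≤ γ * 1 := mul_le_mul_of_nonneg_left h3 hγ.le
    have h6 : γ * (-2) ≤ γ * (m - β) := mul_le_mul_of_nonneg_left (by linarith) hγ.le
    rw [NearBucket, abs_le]
    constructor <;> linarith
  · calc ∑ m ∈ Finset.Ioo 0 (0 + 2 ^ D), e m
        ≤ ∑ m ∈ Finset.range (2 ^ D), ENNReal.ofReal (64 / (n * γ ^ 3) *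
            (if |(m : ℝ) - β| ≤ 1 then 0 else 1 / ((m : ℝ) - β) ^ 2)) := by
          rw [zero_add]
          refine le_of_eq_of_le (Finset.sum_congr rfl fun m hm => ?_)
            (Finset.sum_le_sum_of_subset fun m hm => ?_)
          · simp only [he]
            rw [if_neg (not_lt.2 (Finset.mem_Ioo.1 hm).2.le)]
          · exact Finset.mem_range.2 (Finset.mem_Ioo.1 hm).2
      _ = ENNReal.ofReal (64 / (n * γ ^ 3) * ∑ m ∈ Finset.range (2 ^ D),
            (if |(m : ℝ) - β| ≤ 1 then 0 else 1 / ((m : ℝ) - β) ^ 2)) := by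
          rw [Finset.mul_sum, ENNReal.ofReal_sum_of_nonneg]
          intro m _
          split_ifs <;> positivity
      _ ≤ _ := by
          refine ENNReal.ofReal_le_ofReal ?_
          refine (mul_le_mul_of_nonneg_left (sum_inv_sq_le β _) (by positivity)).trans_eq ?_
          ring

/-- The bucket of a single element, not too light and not in a low quantile, is rarely wrong. -/
theorem IsCondOracle.bucketOf_error (hO : IsCondOracle μ O) {x : Fin N}
    (hμ : 0 < (μ x).toReal) {γ : ℝ} (hγ : 0 < γ) (hγ1 : γ ≤ 1 / 2) {n : ℕ} (hn : 0 < n) {D : ℕ}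
    (hD : Real.exp (-(γ * 2 ^ D)) ≤ (μ x).toReal) (hS : γ / 2 ≤ lightMass μ x) :
    ((CondAlg.bucketOf γ n D x).run O).toOuterMeasure
        {b | ¬ NearBucket γ D (μ x).toReal b} ≤ ENNReal.ofReal (264 / (n * γ ^ 3)) := by
  have hn' : (0 : ℝ) < n := by exact_mod_cast hn
  have hS0 : 0 < lightMass μ x := by linarith
  set S := lightMass μ x with hSdef
  rw [CondAlg.bucketOf, CondAlg.run_bind]
  refine (PMF.toOuterMeasure_bind_le _ _ _ {g | γ / 2 * S ≤ |CondAlg.frac g - S|}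
    (ENNReal.ofReal (256 / (n * γ ^ 3))) fun g hg => ?_).trans ?_
  · have hg' : |CondAlg.frac g - S| < γ / 2 * S := not_le.1 hg
    set s := CondAlg.frac g
    have hg2 := abs_lt.1 hg'
    have hs0 : 0 < s := by nlinarith
    have hlog : |Real.log s - Real.log S| ≤ γ := by
      rw [← Real.log_div hs0.ne' hS0.ne', abs_le]
      constructor
      · rw [Real.le_log_iff_exp_le (by positivity), le_div_iff₀ hS0, Real.exp_neg]
        have h1 := Real.add_one_le_exp γ
        have h2 : (Real.exp γ)⁻¹ ≤ 1 - γ / 2 := by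
          rw [inv_le_iff_one_le_mul₀ (Real.exp_pos γ)]
          nlinarith
        nlinarith
      · refine (Real.log_le_sub_one_of_pos (by positivity)).trans ?_
        rw [sub_le_iff_le_add, div_le_iff₀ hS0]
        nlinarith
    have hmain := hO.search_countTest_error hμ hγ (by linarith) hn hD (s := s) (by nlinarith)
      hlog hS0
    rw [CondAlg.run_bind]
    refine (PMF.toOuterMeasure_bind_le _ _ _ _ 0 fun m hm => ?_).trans
      ((add_zero _).trans_le hmain)
    have hm' : m < 2 ^ D ∧ NearBucket γ D (μ x).toReal m := by
      by_contra h
      exact hm h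
    rw [CondAlg.run, PMF.toOuterMeasure_pure_apply, if_neg]
    simpa [Nat.mod_eq_of_lt hm'.1] using hm'.2
  · calc _ ≤ ENNReal.ofReal (8 / (n * γ ^ 3)) + ENNReal.ofReal (256 / (n * γ ^ 3)) := by
          gcongr
          refine (CondAlg.toOuterMeasure_rep_le O _ (hO.ex_lightTrial hμ) (t := γ / 2 * S)
            (by positivity) hn _ fun g hg => hg).trans (ENNReal.ofReal_le_ofReal ?_)
          have h1 := lightMass_le_one μ x
          rw [← hSdef] at h1 ⊢
          rw [div_le_div_iff₀ (by positivity) (by positivity)]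
          have : S * (1 - S) * (n * γ ^ 3) ≤ S * 1 * (n * γ ^ 3) := by gcongr; linarith
          have : n * γ ^ 2 * S * γ ≤ n * γ ^ 2 * S * (2 * S) := by gcongr; linarith
          nlinarith
      _ = _ := by
          rw [← ENNReal.ofReal_add (by positivity) (by positivity)]
          congr 1
          ring

end

/-! ### From bucket histograms to permutations -/

/-- A sub-doubly-stochastic fractional matching is dominated in value by a permutation. -/
theorem exists_perm_sum_le {ι : Type} [Fintype ι] [DecidableEq ι] (A c : ι → ι → ℝ)
    (hA : ∀ i j, 0 ≤ A i j) (hc : ∀ i j, 0 ≤ c i j) (hrow : ∀ i, ∑ j, A i j ≤ 1)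
    (hcol : ∀ j, ∑ i, A i j ≤ 1) :
    ∃ π : Equiv.Perm ι, ∑ i, ∑ j, c i j * A i j ≤ ∑ i, c i (π i) := by
  -- spread the missing mass proportionally to the row and column deficits
  set T : ℝ := ∑ i, (1 - ∑ j, A i j) with hT
  have hT' : T = ∑ j, (1 - ∑ i, A i j) := by
    rw [hT, Finset.sum_sub_distrib, Finset.sum_sub_distrib, Finset.sum_comm]
  have hT0 : 0 ≤ T := Finset.sum_nonneg fun i _ => sub_nonneg.2 (hrow i)
  set M : Matrix ι ι ℝ :=
    Matrix.of fun i j => A i j + (1 - ∑ k, A i k) * (1 - ∑ k, A k j) / T with hM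
  have hAM : ∀ i j, A i j ≤ M i j := fun i j => by
    have := mul_nonneg (sub_nonneg.2 (hrow i)) (sub_nonneg.2 (hcol j))
    simp only [hM, Matrix.of_apply]
    linarith [div_nonneg this hT0]
  have hdef : ∀ a : ℝ, (T = 0 → a = 0) → a * T / T = a := fun a ha => by
    rcases eq_or_ne T 0 with h | h
    · rw [ha h, zero_mul, zero_div]
    · exact mul_div_cancel_right₀ a h
  have hds : M ∈ doublyStochastic ℝ ι := by
    rw [mem_doublyStochastic_iff_sum]
    refine ⟨fun i j => (hA i j).trans (hAM i j), fun i => ?_, fun j => ?_⟩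
    · simp only [hM, Matrix.of_apply, Finset.sum_add_distrib, ← Finset.sum_div, ← Finset.mul_sum]
      rw [← hT', hdef, add_sub_cancel]
      intro h
      exact (Finset.sum_eq_zero_iff_of_nonneg fun i _ => sub_nonneg.2 (hrow i)).1 h i
        (Finset.mem_univ i)
    · simp only [hM, Matrix.of_apply, Finset.sum_add_distrib, ← Finset.sum_div, ← Finset.sum_mul]
      rw [← hT, mul_comm, hdef, add_sub_cancel]
      intro h
      rw [hT'] at h
      exact (Finset.sum_eq_zero_iff_of_nonneg fun i _ => sub_nonneg.2 (hcol i)).1 h j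
        (Finset.mem_univ j)
  obtain ⟨w, hw0, hw1, hwM⟩ := exists_eq_sum_perm_of_mem_doublyStochastic hds
  have hval : ∑ i, ∑ j, c i j * M i j = ∑ σ : Equiv.Perm ι, w σ * ∑ i, c i (σ i) := by
    rw [← hwM]
    simp only [Matrix.sum_apply, Matrix.smul_apply, Finset.mul_sum, smul_eq_mul]
    calc ∑ i, ∑ j, ∑ σ, c i j * (w σ * (Equiv.Perm.permMatrix ℝ σ) i j)
        = ∑ σ, ∑ i, ∑ j, c i j * (w σ * (Equiv.Perm.permMatrix ℝ σ) i j) := by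
          exact (Finset.sum_congr rfl fun i _ => Finset.sum_comm).trans Finset.sum_comm
      _ = _ := by
          refine Finset.sum_congr rfl fun σ _ => Finset.sum_congr rfl fun i _ => ?_
          rw [Finset.sum_eq_single (σ i)]
          · simp [Equiv.Perm.permMatrix, PEquiv.toMatrix_apply]
            ring
          · intro j _ hj
            simp [Equiv.Perm.permMatrix, PEquiv.toMatrix_apply, hj.symm]
          · simp
  by_contra! hcon
  have h1 : ∑ i, ∑ j, c i j * A i j ≤ ∑ i, ∑ j, c i j * M i j :=
    Finset.sum_le_sum fun i _ => Finset.sum_le_sum fun j _ =>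
      mul_le_mul_of_nonneg_left (hAM i j) (hc i j)
  obtain ⟨σ₀, hσ₀⟩ : ∃ σ, 0 < w σ := by
    by_contra! h
    have := Finset.sum_nonpos fun σ (_ : σ ∈ Finset.univ) => h σ
    linarith
  have h2 : ∑ σ : Equiv.Perm ι, w σ * ∑ i, c i (σ i) <
      ∑ σ : Equiv.Perm ι, w σ * ∑ i, ∑ j, c i j * A i j :=
    Finset.sum_lt_sum (fun σ _ => mul_le_mul_of_nonneg_left (hcon σ).le (hw0 σ))
      ⟨σ₀, Finset.mem_univ _, mul_lt_mul_of_pos_left (hcon σ₀) hσ₀⟩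
  rw [← Finset.sum_mul, hw1, one_mul] at h2
  linarith

section

variable {N : ℕ}

/-- The distribution `τ` explains the bucket weights `ν` up to an error `κ`: all but `κ` of the
mass can be transported from the elements to the buckets such that each element only sends mass to
buckets that agree with its own mass. -/
def Explains (γ : ℝ) (D : ℕ) (κ : ℝ) (ν : Fin (2 ^ D) → ℝ) (τ : PMF (Fin N)) : Prop :=
  ∃ W : Fin N → Fin (2 ^ D) → ℝ, (∀ x b, 0 ≤ W x b) ∧ (∀ x, ∑ b, W x b ≤ (τ x).toReal) ∧
    (∀ b, ∑ x, W x b ≤ ν b) ∧ (∀ x b, W x b ≠ 0 → NearBucket γ D (τ x).toReal b) ∧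
    1 - κ ≤ ∑ x, ∑ b, W x b

/-- Two distributions explaining the same bucket weights have a partial coupling supported on
pairs of elements with nearly the same mass. -/
theorem Explains.exists_coupling {γ : ℝ} {D : ℕ} {κ : ℝ} {ν : Fin (2 ^ D) → ℝ}
    {μ τ : PMF (Fin N)} (hμ : Explains γ D κ ν μ) (hτ : Explains γ D κ ν τ)
    (hν : ∑ b, ν b = 1) :
    ∃ ω : Fin N → Fin N → ℝ, (∀ x y, 0 ≤ ω x y) ∧ (∀ x, ∑ y, ω x y ≤ (μ x).toReal) ∧
      (∀ y, ∑ x, ω x y ≤ (τ y).toReal) ∧ (∀ x y, ω x y ≠ 0 → 0 < (μ x).toReal ∧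
        0 < (τ y).toReal ∧ |Real.log (μ x).toReal - Real.log (τ y).toReal| ≤ 6 * γ) ∧
      1 - 2 * κ ≤ ∑ x, ∑ y, ω x y := by
  obtain ⟨W, hW0, hW1, hW2, hW3, hW4⟩ := hμ
  obtain ⟨V, hV0, hV1, hV2, hV3, hV4⟩ := hτ
  have hν0 : ∀ b, 0 ≤ ν b := fun b => (Finset.sum_nonneg fun x _ => hW0 x b).trans (hW2 b)
  refine ⟨fun x y => ∑ b, W x b * V y b / ν b, fun x y => Finset.sum_nonneg fun b _ =>
    div_nonneg (mul_nonneg (hW0 x b) (hV0 y b)) (hν0 b), fun x => ?_, fun y => ?_, fun x y h => ?_,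
    ?_⟩
  · rw [Finset.sum_comm]
    refine (Finset.sum_le_sum fun b _ => ?_).trans (hW1 x)
    rw [← Finset.sum_div, ← Finset.mul_sum, mul_div_assoc]
    exact mul_le_of_le_one_right (hW0 x b) (div_le_one_of_le₀ (hV2 b) (hν0 b))
  · rw [Finset.sum_comm]
    refine (Finset.sum_le_sum fun b _ => ?_).trans (hV1 y)
    rw [← Finset.sum_div, ← Finset.sum_mul, mul_comm, mul_div_assoc]
    exact mul_le_of_le_one_right (hV0 y b) (div_le_one_of_le₀ (hW2 b) (hν0 b))
  · obtain ⟨b, -, hb⟩ := Finset.exists_ne_zero_of_sum_ne_zero h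
    have hWb : W x b ≠ 0 := fun h => hb (by rw [h, zero_mul, zero_div])
    have hVb : V y b ≠ 0 := fun h => hb (by rw [h, mul_zero, zero_div])
    refine ⟨?_, ?_, ?_⟩
    · exact ((hW0 x b).lt_of_ne' hWb).trans_le
        ((Finset.single_le_sum (fun b _ => hW0 x b) (Finset.mem_univ b)).trans (hW1 x))
    · exact ((hV0 y b).lt_of_ne' hVb).trans_le
        ((Finset.single_le_sum (fun b _ => hV0 y b) (Finset.mem_univ b)).trans (hV1 y))
    · have h1 := abs_le.1 (hW3 x b hWb)
      have h2 := abs_le.1 (hV3 y b hVb)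
      rw [abs_le]
      constructor <;> linarith
  · -- in each bucket, `w * v / ν ≥ w + v - ν` because `w, v ≤ ν`
    have key : ∀ b, ∑ x, W x b + ∑ y, V y b - ν b ≤ ∑ x, ∑ y, W x b * V y b / ν b := by
      intro b
      simp only [← Finset.sum_div, ← Finset.mul_sum, ← Finset.sum_mul]
      have h1 := hW2 b
      have h2 := hV2 b
      have h3 : 0 ≤ ∑ x, W x b := Finset.sum_nonneg fun x _ => hW0 x b
      have h4 : 0 ≤ ∑ y, V y b := Finset.sum_nonneg fun x _ => hV0 x b
      rcases (hν0 b).eq_or_lt with h | h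
      · rw [← h, div_zero]
        linarith
      · rw [le_div_iff₀ h]
        nlinarith
    have h1 : ∑ x, ∑ y, ∑ b, W x b * V y b / ν b = ∑ b, ∑ x, ∑ y, W x b * V y b / ν b := by
      rw [Finset.sum_comm (s := (Finset.univ : Finset (Fin (2 ^ D))))]
      exact Finset.sum_congr rfl fun x _ => Finset.sum_comm
    have h2 := Finset.sum_le_sum fun b (_ : b ∈ Finset.univ) => key b
    rw [Finset.sum_sub_distrib, Finset.sum_add_distrib, hν, Finset.sum_comm,
      Finset.sum_comm (f := fun b y => V y b)] at h2
    rw [h1]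
    linarith

/-- Dividing the coupling by the masses of the first distribution gives an almost
sub-doubly-stochastic matrix, from which Birkhoff's theorem extracts the permutation. -/
theorem Explains.histDiv_le {γ : ℝ} {D : ℕ} {κ ε : ℝ} {ν : Fin (2 ^ D) → ℝ}
    {μ τ : PMF (Fin N)} (hμ : Explains γ D κ ν μ) (hτ : Explains γ D κ ν τ)
    (hν : ∑ b, ν b = 1) (hγ : 0 ≤ γ) (hκ : 0 ≤ κ) (hε : ε ≤ 1) (hγε : 12 * γ ≤ ε)
    (hκε : 6 * γ + 2 * κ ≤ ε) : histDiv μ τ ≤ ε := by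
  classical
  obtain ⟨ω, h0, hrow, hcol, hsupp, htot⟩ := hμ.exists_coupling hτ hν
  have hexp1 : Real.exp (6 * γ) ≤ 1 + ε := by
    have h1 := Real.add_one_le_exp (-(6 * γ))
    have h2 : Real.exp (6 * γ) * Real.exp (-(6 * γ)) = 1 := by
      rw [← Real.exp_add, add_neg_cancel, Real.exp_zero]
    have h3 := Real.exp_pos (6 * γ)
    nlinarith
  have hexp2 : 1 - 6 * γ ≤ Real.exp (-(6 * γ)) := by
    have h1 := Real.add_one_le_exp (-(6 * γ))
    linarith
  have hexp3 : Real.exp (-(6 * γ)) ≤ 1 := Real.exp_le_one_iff.2 (by linarith)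
  have he0 := Real.exp_pos (-(6 * γ))
  set near : Fin N → Fin N → Prop := fun x y => 0 < (μ x).toReal ∧ 0 < (τ y).toReal ∧
    |Real.log (μ x).toReal - Real.log (τ y).toReal| ≤ 6 * γ with hnear
  have hfac : ∀ x y, near x y → (μ x).toReal ≤ Real.exp (6 * γ) * (τ y).toReal ∧
      Real.exp (-(6 * γ)) * (τ y).toReal ≤ (μ x).toReal := by
    rintro x y ⟨h1, h2, h3⟩
    have h4 := abs_le.1 h3
    constructor
    · rw [← Real.log_le_log_iff h1 (by positivity), Real.log_mul (Real.exp_pos _).ne' h2.ne',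
        Real.log_exp]
      linarith
    · rw [← Real.log_le_log_iff (by positivity) h1, Real.log_mul (Real.exp_pos _).ne' h2.ne',
        Real.log_exp]
      linarith
  obtain ⟨π, hπ⟩ := exists_perm_sum_le (fun x y => Real.exp (-(6 * γ)) * (ω x y / (μ x).toReal))
    (fun x y => if near x y then (μ x).toReal else 0)
    (fun x y => mul_nonneg he0.le (div_nonneg (h0 x y) ENNReal.toReal_nonneg))
    (fun x y => by split_ifs; exacts [ENNReal.toReal_nonneg, le_rfl])
    (fun x => by
      rw [← Finset.mul_sum, ← Finset.sum_div]
      exact mul_le_one₀ hexp3 (div_nonneg (Finset.sum_nonneg fun y _ => h0 x y)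
        ENNReal.toReal_nonneg) (div_le_one_of_le₀ (hrow x) ENNReal.toReal_nonneg))
    (fun y => by
      rcases (ENNReal.toReal_nonneg : 0 ≤ (τ y).toReal).eq_or_lt with h | h
      · have hz : ∀ x, ω x y = 0 := fun x => by
          by_contra hne
          exact (hsupp x y hne).2.1.ne h
        simp [hz]
      · calc ∑ x, Real.exp (-(6 * γ)) * (ω x y / (μ x).toReal)
            ≤ ∑ x, ω x y / (τ y).toReal := by
              refine Finset.sum_le_sum fun x _ => ?_
              by_cases hne : ω x y = 0
              · simp [hne]
              · have hs := hsupp x y hne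
                have hf := (hfac x y hs).2
                rw [mul_div_assoc', div_le_div_iff₀ hs.1 h]
                nlinarith [h0 x y]
          _ ≤ 1 := by
              rw [← Finset.sum_div]
              exact div_le_one_of_le₀ (hcol y) h.le)
  have hval : ∑ x, ∑ y, (if near x y then (μ x).toReal else 0) *
      (Real.exp (-(6 * γ)) * (ω x y / (μ x).toReal)) =
      Real.exp (-(6 * γ)) * ∑ x, ∑ y, ω x y := by
    simp only [Finset.mul_sum]
    refine Finset.sum_congr rfl fun x _ => Finset.sum_congr rfl fun y _ => ?_
    by_cases hne : ω x y = 0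
    · simp [hne]
    · have hs := hsupp x y hne
      rw [if_pos hs]
      have := hs.1.ne'
      field_simp
  rw [hval] at hπ
  have hbdd : BddBelow {δ : ℝ | 0 ≤ δ ∧ ∃ π : Equiv.Perm (Fin N), mismatchProb μ τ π δ ≤ δ} :=
    ⟨0, fun δ hδ => hδ.1⟩
  refine csInf_le hbdd ⟨by linarith, π, ?_⟩
  have hsplit : ∑ x, (if near x (π x) then 0 else (μ x).toReal) +
      ∑ x, (if near x (π x) then (μ x).toReal else 0) = 1 := by
    rw [← Finset.sum_add_distrib, ← μ.sum_toReal]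
    refine Finset.sum_congr rfl fun x _ => ?_
    split_ifs <;> simp
  have hmis : mismatchProb μ τ π ε ≤ ∑ x, (if near x (π x) then 0 else (μ x).toReal) := by
    rw [mismatchProb, Finset.sum_filter]
    refine Finset.sum_le_sum fun x _ => ?_
    by_cases hn : near x (π x)
    · have hf := hfac x (π x) hn
      rw [if_pos hn, if_neg]
      rw [not_not]
      have := hn.2.1
      constructor <;> nlinarith
    · rw [if_neg hn]
      split_ifs
      · exact ENNReal.toReal_nonneg
      · exact le_rfl
  have : (1 - 6 * γ) * (1 - 2 * κ) ≤ Real.exp (-(6 * γ)) * ∑ x, ∑ y, ω x y := by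
    have hω : 0 ≤ ∑ x, ∑ y, ω x y :=
      Finset.sum_nonneg fun x _ => Finset.sum_nonneg fun y _ => h0 x y
    calc (1 - 6 * γ) * (1 - 2 * κ) ≤ (1 - 6 * γ) * ∑ x, ∑ y, ω x y :=
          mul_le_mul_of_nonneg_left htot (by linarith)
      _ ≤ _ := mul_le_mul_of_nonneg_right hexp2 hω
  have := mul_nonneg hγ hκ
  linarith

/-- Bucket weights close to the bucket distribution of a random assignment that mostly sends
elements to buckets agreeing with their mass are explained by the distribution itself. -/
theorem explains_of_sum_abs_le {γ : ℝ} {D : ℕ} {κ₁ κ₂ : ℝ} {ν : Fin (2 ^ D) → ℝ}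
    {μ : PMF (Fin N)} (K : Fin N → PMF (Fin (2 ^ D))) (hν : ∀ b, 0 ≤ ν b)
    (hbad : ∑ x, (μ x).toReal * ((K x).toOuterMeasure
      {b | ¬ NearBucket γ D (μ x).toReal b}).toReal ≤ κ₁)
    (hdist : ∑ b, |ν b - ((μ.bind K) b).toReal| ≤ κ₂) : Explains γ D (κ₁ + κ₂) ν μ := by
  classical
  set J : Fin N → Fin (2 ^ D) → ℝ := fun x b => (μ x).toReal * (K x b).toReal with hJ
  have hJ0 : ∀ x b, 0 ≤ J x b := fun x b => mul_nonneg ENNReal.toReal_nonneg ENNReal.toReal_nonneg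
  set ρ : Fin (2 ^ D) → ℝ := fun b => ((μ.bind K) b).toReal with hρ
  have hρJ : ∀ b, ρ b = ∑ x, J x b := fun b => by
    simp only [hρ, hJ]
    rw [PMF.bind_apply, tsum_fintype, ENNReal.toReal_sum fun a _ =>
      ENNReal.mul_ne_top (μ.apply_ne_top a) ((K a).apply_ne_top b)]
    simp
  have hρ0 : ∀ b, 0 ≤ ρ b := fun b => ENNReal.toReal_nonneg
  set m : Fin (2 ^ D) → ℝ := fun b => min 1 (ν b / ρ b) with hm
  have hm0 : ∀ b, 0 ≤ m b := fun b => le_min zero_le_one (div_nonneg (hν b) (hρ0 b))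
  have hm1 : ∀ b, m b ≤ 1 := fun b => min_le_left _ _
  have hmρ : ∀ b, ρ b * m b ≤ ν b := fun b => by
    rcases (hρ0 b).eq_or_lt with h | h
    · rw [← h, zero_mul]
      exact hν b
    · calc ρ b * m b ≤ ρ b * (ν b / ρ b) := mul_le_mul_of_nonneg_left (min_le_right _ _) h.le
        _ = ν b := by field_simp
  have hloss : ∀ b, ρ b * (1 - m b) ≤ |ν b - ρ b| := fun b => by
    rcases (hρ0 b).eq_or_lt with h | h
    · rw [← h, zero_mul]
      exact abs_nonneg _
    · rcases min_choice 1 (ν b / ρ b) with h1 | h1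
      · simp only [hm, h1, sub_self, mul_zero]
        exact abs_nonneg _
      · simp only [hm, h1]
        rw [mul_sub, mul_div_cancel₀ _ h.ne', mul_one, abs_sub_comm]
        exact le_abs_self _
  -- send each element to its good buckets, scaled down where a bucket is overfull
  refine ⟨fun x b => if NearBucket γ D (μ x).toReal b then J x b * m b else 0, fun x b => ?_,
    fun x => ?_, fun b => ?_, fun x b h => ?_, ?_⟩
  · dsimp only
    split_ifs
    exacts [mul_nonneg (hJ0 x b) (hm0 b), le_rfl]
  · calc _ ≤ ∑ b, J x b := by
          refine Finset.sum_le_sum fun b _ => ?_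
          dsimp only
          split_ifs
          exacts [mul_le_of_le_one_right (hJ0 x b) (hm1 b), hJ0 x b]
      _ = _ := by rw [← Finset.mul_sum, PMF.sum_toReal, mul_one]
  · calc _ ≤ ∑ x, J x b * m b := by
          refine Finset.sum_le_sum fun x _ => ?_
          dsimp only
          split_ifs
          exacts [le_rfl, mul_nonneg (hJ0 x b) (hm0 b)]
      _ ≤ _ := by
          rw [← Finset.sum_mul, ← hρJ]
          exact hmρ b
  · by_contra hn
    exact h (if_neg hn)
  · have hbad' : ∀ x, (μ x).toReal * ((K x).toOuterMeasure
        {b | ¬ NearBucket γ D (μ x).toReal b}).toReal =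
        ∑ b : Fin (2 ^ D), if NearBucket γ D (μ x).toReal b then 0 else J x b := fun x => by
      rw [PMF.toOuterMeasure_apply, tsum_fintype, ENNReal.toReal_sum, Finset.mul_sum]
      · refine Finset.sum_congr rfl fun b _ => ?_
        by_cases hb : NearBucket γ D (μ x).toReal b
        · simp [hb]
        · simp [hb, hJ]
      · intro b _
        rw [Set.indicator_apply]
        split_ifs
        exacts [(K x).apply_ne_top b, ENNReal.zero_ne_top]
    simp only [hbad'] at hbad
    have h1 : ∑ x, ∑ b, J x b = 1 := by
      simp only [hJ, ← Finset.mul_sum, PMF.sum_toReal, mul_one]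
    have h2 : ∑ x, ∑ b, J x b * (1 - m b) ≤ κ₂ := by
      rw [Finset.sum_comm]
      refine (Finset.sum_le_sum fun b _ => ?_).trans hdist
      rw [← Finset.sum_mul, ← hρJ]
      exact hloss b
    have h3 : ∑ x, ∑ b, J x b ≤
        ∑ x, ∑ b : Fin (2 ^ D), (if NearBucket γ D (μ x).toReal b then J x b * m b else 0) +
        ∑ x, ∑ b : Fin (2 ^ D), (if NearBucket γ D (μ x).toReal b then 0 else J x b) +
        ∑ x, ∑ b, J x b * (1 - m b) := by
      simp only [← Finset.sum_add_distrib]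
      refine Finset.sum_le_sum fun x _ => Finset.sum_le_sum fun b _ => ?_
      have := mul_nonneg (hJ0 x b) (sub_nonneg.2 (hm1 b))
      split_ifs <;> linarith
    linarith

end

/-! ### The learning algorithm -/

/-- The empirical frequencies in a finite sequence. -/
noncomputable def empirical {R : Type} [DecidableEq R] {n : ℕ} (g : Fin n → R) (b : R) : ℝ :=
  (∑ i, if g i = b then (1 : ℝ) else 0) / n

theorem sum_empirical {R : Type} [Fintype R] [DecidableEq R] {n : ℕ} (hn : 0 < n)
    (g : Fin n → R) : ∑ b, empirical g b = 1 := by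
  have hn' : (n : ℝ) ≠ 0 := by exact_mod_cast hn.ne'
  simp only [empirical]
  rw [← Finset.sum_div, Finset.sum_comm]
  simp [hn']

/-- The empirical distribution of `n` independent runs of an algorithm with `k` possible results
is within `L¹` distance about `√(k / n)` of the true one. -/
theorem CondAlg.toOuterMeasure_empirical_le {N : ℕ} {R : Type} [Fintype R] [DecidableEq R]
    (O : Set (Fin N) → PMF (Option (Fin N))) (a : CondAlg N R) {n : ℕ} (hn : 0 < n) {t : ℝ}
    (ht : 0 < t) :
    ((a.rep n).run O).toOuterMeasure
        {g | t < ∑ b, |empirical g b - (a.run O b).toReal|} ≤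
      ENNReal.ofReal (Fintype.card R / (n * t ^ 2)) := by
  have hn' : (0 : ℝ) < n := by exact_mod_cast hn
  set ν : R → ℝ := fun b => (a.run O b).toReal with hν
  set φ : R → R → ℝ := fun b r => (if r = b then 1 else 0) + -ν b with hφ
  have hind : ∀ b, (a.run O).ex (fun r => if r = b then 1 else 0) = ν b := fun b => by
    simp [PMF.ex, hν]
  have h0 : ∀ b, (a.run O).ex (φ b) = 0 := fun b => by
    simp only [hφ]
    rw [PMF.ex_add, PMF.ex_const, hind]
    ring
  have h2 : ∀ b, (a.run O).ex (fun r => φ b r ^ 2) ≤ ν b := fun b => by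
    have : (fun r => φ b r ^ 2) =
        fun r => (1 - 2 * ν b) * (if r = b then (1 : ℝ) else 0) + ν b ^ 2 := by
      funext r
      simp only [hφ]
      split_ifs <;> ring
    rw [this, PMF.ex_add, PMF.ex_mul_left, PMF.ex_const, hind]
    nlinarith [sq_nonneg (ν b)]
  have hs : ∀ (g : Fin n → R) b, ∑ i, φ b (g i) = n * (empirical g b - ν b) := fun g b => by
    simp only [hφ, Finset.sum_add_distrib, empirical]
    field_simp
    simp
    ring
  refine (PMF.toOuterMeasure_le_ex _ _ (fun g =>
    (∑ b, (∑ i, φ b (g i)) ^ 2) * (Fintype.card R / (n * t) ^ 2))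
    (fun g => by positivity) fun g hg => ?_).trans (ENNReal.ofReal_le_ofReal ?_)
  · have hg' : t < ∑ b, |empirical g b - ν b| := hg
    have hcs := sq_sum_le_card_mul_sum_sq (s := (Finset.univ : Finset R))
      (f := fun b => |empirical g b - ν b|)
    simp only [sq_abs, Finset.card_univ] at hcs
    have ht2 : t ^ 2 ≤ (∑ b, |empirical g b - ν b|) ^ 2 := by gcongr
    simp only [hs, mul_pow, ← Finset.mul_sum]
    rw [mul_div_assoc', one_le_div (by positivity)]
    have := mul_le_mul_of_nonneg_left (ht2.trans hcs) (sq_nonneg (n : ℝ))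
    nlinarith
  · have hsum : ∑ b, ν b = 1 := PMF.sum_toReal _
    rw [PMF.ex_mul_right, PMF.ex_sum]
    have hle : ∑ b, ((a.rep n).run O).ex (fun g => (∑ i, φ b (g i)) ^ 2) ≤ n := by
      calc _ ≤ ∑ b, n * ν b := by
            refine Finset.sum_le_sum fun b _ => ?_
            rw [ex_rep_sum_sq O a (φ b) (h0 b)]
            exact mul_le_mul_of_nonneg_left (h2 b) hn'.le
        _ = n := by rw [← Finset.mul_sum, hsum, mul_one]
    calc _ ≤ (n : ℝ) * (Fintype.card R / (n * t) ^ 2) :=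
          mul_le_mul_of_nonneg_right hle (by positivity)
      _ = _ := by field_simp

section

variable {N : ℕ}

/-- Draw an element and determine its bucket. -/
noncomputable def CondAlg.sampleBucket (N : ℕ) (γ : ℝ) (n D : ℕ) : CondAlg N (Fin (2 ^ D)) :=
  .query (Finset.univ : Finset (Fin N)) fun y =>
    match y with
    | none => .output 0
    | some x => bucketOf γ n D x

/-- Determine the buckets of `s` independent samples, and return a distribution that explains the
empirical distribution of the buckets, if there is one. -/
noncomputable def CondAlg.histogramLearner (N : ℕ) [Nonempty (PMF (Fin N))] (γ κ : ℝ)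
    (n D s : ℕ) : CondAlg N (PMF (Fin N)) :=
  ((sampleBucket N γ n D).rep s).bind fun g =>
    .output (Classical.epsilon (Explains γ D κ (empirical g)))

theorem CondAlg.usesAtMost_histogramLearner [Nonempty (PMF (Fin N))] (γ κ : ℝ) (n D s : ℕ) :
    (histogramLearner N γ κ n D s).UsesAtMost (s * (n * 2 + D * n + 1)) := by
  have h : (sampleBucket N γ n D).UsesAtMost (n * 2 + D * n + 1) := fun y => by
    cases y with
    | none => trivial
    | some x => exact usesAtMost_bucketOf γ n D x
  exact (h.rep s).bind (q' := 0) fun g => trivial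

variable {μ : PMF (Fin N)} {O : Set (Fin N) → PMF (Option (Fin N))}

theorem IsCondOracle.run_sampleBucket (hO : IsCondOracle μ O) (γ : ℝ) (n D : ℕ) :
    (CondAlg.sampleBucket N γ n D).run O = μ.bind fun x => (CondAlg.bucketOf γ n D x).run O := by
  obtain ⟨x, hx⟩ := μ.support_nonempty
  have h : O (Finset.univ : Finset (Fin N)) = μ.map some := by
    rw [hO _ ⟨x, Finset.mem_coe.2 (Finset.mem_univ x), hx⟩]
    congr 1
    ext a
    have := μ.tsum_coe
    rw [tsum_fintype] at this
    simp [PMF.filter_apply, this]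
  rw [CondAlg.sampleBucket, CondAlg.run, h, ← PMF.bind_pure_comp, PMF.bind_bind]
  simp

/-- The random bucket of a random element usually agrees with the mass of the element: exceptions
are elements below the grid, elements in a low quantile, and failures of the estimator. -/
theorem IsCondOracle.sum_bucketOf_error (hO : IsCondOracle μ O) {γ : ℝ} (hγ : 0 < γ)
    (hγ1 : γ ≤ 1 / 2) {n : ℕ} (hn : 0 < n) (D : ℕ) :
    ∑ x, (μ x).toReal * (((CondAlg.bucketOf γ n D x).run O).toOuterMeasure
      {b | ¬ NearBucket γ D (μ x).toReal b}).toReal ≤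
      N * Real.exp (-(γ * 2 ^ D)) + γ + 264 / (n * γ ^ 3) := by
  classical
  have hn' : (0 : ℝ) < n := by exact_mod_cast hn
  set err : ℝ := 264 / (n * γ ^ 3) with herr
  have herr0 : 0 ≤ err := by positivity
  have he0 := Real.exp_pos (-(γ * 2 ^ D))
  calc _ ≤ ∑ x, (Real.exp (-(γ * 2 ^ D)) +
        (if 0 < (μ x).toReal ∧ lightMass μ x < γ / 2 then (μ x).toReal else 0) +
        (μ x).toReal * err) := by
        refine Finset.sum_le_sum fun x _ => ?_
        have hp0 : 0 ≤ (μ x).toReal := ENNReal.toReal_nonneg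
        set P := (CondAlg.bucketOf γ n D x).run O
        have hP1 : (P.toOuterMeasure {b | ¬ NearBucket γ D (μ x).toReal b}).toReal ≤ 1 := by
          rw [← ENNReal.toReal_one]
          refine ENNReal.toReal_mono ENNReal.one_ne_top ?_
          exact (MeasureTheory.measure_mono (Set.subset_univ _)).trans_eq
            ((P.toOuterMeasure_apply_eq_one_iff _).2 (Set.subset_univ _))
        have h1 := mul_le_of_le_one_right hp0 hP1
        have h2 : 0 ≤ (μ x).toReal * err := mul_nonneg hp0 herr0
        by_cases hD : (μ x).toReal < Real.exp (-(γ * 2 ^ D))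
        · split_ifs <;> linarith
        · have hμ : 0 < (μ x).toReal := he0.trans_le (not_lt.1 hD)
          by_cases hS : lightMass μ x < γ / 2
          · rw [if_pos ⟨hμ, hS⟩]
            linarith
          · rw [if_neg fun h => hS h.2]
            have h3 := hO.bucketOf_error hμ hγ hγ1 hn (not_lt.1 hD) (not_lt.1 hS)
            have h4 := ENNReal.toReal_mono ENNReal.ofReal_ne_top h3
            rw [ENNReal.toReal_ofReal herr0] at h4
            have := mul_le_mul_of_nonneg_left h4 hp0
            linarith
    _ ≤ _ := by
        rw [Finset.sum_add_distrib, Finset.sum_add_distrib, ← Finset.sum_mul, PMF.sum_toReal,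
          one_mul, Finset.sum_const, Finset.card_univ, Fintype.card_fin, nsmul_eq_mul,
          ← Finset.sum_filter]
        have := sum_lightMass_lt_le μ hγ.le
        linarith

theorem CondAlg.histogramLearner_learns [Nonempty (PMF (Fin N))] {ε γ : ℝ} (hε1 : ε < 1)
    (hγ : 0 < γ) (hγε : 16 * γ = ε) {n D s : ℕ} (hn : 0 < n) (hs : 0 < s)
    (hD : N * Real.exp (-(γ * 2 ^ D)) ≤ ε / 64) (hn1 : 264 / (n * γ ^ 3) ≤ ε / 32)
    (hs1 : (2 : ℝ) ^ D / (s * (ε / 8) ^ 2) ≤ 1 / 4) :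
    (histogramLearner N γ (ε / 4) n D s).LearnsHistogram ε := by
  intro μ O hO
  set P := (histogramLearner N γ (ε / 4) n D s).run O with hP
  have hbad : P.toOuterMeasure {τ | ¬ histDiv μ τ ≤ ε} ≤ ENNReal.ofReal (1 / 4) := by
    rw [hP, histogramLearner, run_bind]
    refine (PMF.toOuterMeasure_bind_le _ _ _ {g | ε / 8 < ∑ b, |empirical g b -
      ((sampleBucket N γ n D).run O b).toReal|} 0 fun g hg => ?_).trans ?_
    · have hg' : ¬ ε / 8 < ∑ b, |empirical g b - ((sampleBucket N γ n D).run O b).toReal| := hg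
      rw [not_lt] at hg'
      rw [hO.run_sampleBucket] at hg'
      have hexp : Explains γ D (ε / 4) (empirical g) μ := by
        have h := explains_of_sum_abs_le (κ₁ := ε / 8) (γ := γ) (ν := empirical g)
          (fun x => (bucketOf γ n D x).run O) (fun b => ?_) ?_ hg'
        · rwa [show ε / 8 + ε / 8 = ε / 4 by ring] at h
        · rw [empirical]
          positivity
        · refine (hO.sum_bucketOf_error hγ (by linarith) hn D).trans ?_
          linarith
      have hτ : Explains γ D (ε / 4) (empirical g)
          (Classical.epsilon (Explains γ D (ε / 4) (empirical g)) : PMF (Fin N)) :=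
        Classical.epsilon_spec (p := Explains γ D (ε / 4) (empirical g)) ⟨μ, hexp⟩
      have hdiv := hexp.histDiv_le hτ (sum_empirical hs g) hγ.le (by linarith) hε1.le
        (by linarith) (by linarith)
      rw [run, PMF.toOuterMeasure_pure_apply, if_neg]
      exact fun h => h hdiv
    · rw [add_zero]
      refine (toOuterMeasure_empirical_le O _ hs (by linarith)).trans
        (ENNReal.ofReal_le_ofReal ?_)
      rw [Fintype.card_fin]
      push_cast
      exact hs1
  have huniv : 1 ≤ P.toOuterMeasure {τ | histDiv μ τ ≤ ε} +
      P.toOuterMeasure {τ | ¬ histDiv μ τ ≤ ε} := by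
    refine le_trans ?_ (MeasureTheory.measure_union_le _ _)
    refine ((P.toOuterMeasure_apply_eq_one_iff _).2 fun τ _ => ?_).ge
    exact em (histDiv μ τ ≤ ε)
  by_contra hcon
  have h1 : (1 : ENNReal) ≤ 2 / 3 + ENNReal.ofReal (1 / 4) :=
    huniv.trans (add_le_add (not_lt.1 hcon) hbad)
  have h2 : (2 / 3 : ENNReal) = ENNReal.ofReal (2 / 3) := by
    rw [ENNReal.ofReal_div_of_pos (by norm_num)]
    norm_num
  rw [h2, ← ENNReal.ofReal_add (by norm_num) (by norm_num), ENNReal.one_le_ofReal] at h1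
  norm_num at h1

end

/-! ### Counting the samples -/

/-- A grid of size comparable to `log (N / ε) / ε` suffices; the depth of the binary search in it
is of order `log log N`, up to factors depending on `ε` only. -/
theorem exists_grid_size {l L ε : ℝ} (hl : Real.log 3 ≤ l) (hL : 0 ≤ L) (hε : 0 < ε)
    (hLε : L = Real.log (1 / ε)) (hε1 : ε < 1) :
    ∃ D : ℕ, 16 * (Real.log 64 + l + L) / ε ≤ 2 ^ D ∧ 2 ^ D ≤ 2048 * l * (1 + L) / ε ∧
      (D : ℝ) + 3 ≤ (4110 / Real.log (Real.log 3) + 2) * Real.log l * (1 + L) := by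
  have h3 : 1 < Real.log 3 := by
    rw [Real.lt_log_iff_exp_lt (by norm_num)]
    linarith [Real.exp_one_lt_d9]
  have hc : 0 < Real.log (Real.log 3) := Real.log_pos h3
  have hl1 : 1 < l := by linarith
  have hcl : Real.log (Real.log 3) ≤ Real.log l := Real.log_le_log (by linarith) hl
  have h64 : Real.log 64 ≤ 63 := by
    have := Real.log_le_sub_one_of_pos (show (0 : ℝ) < 64 by norm_num)
    linarith
  have h64' : 0 ≤ Real.log 64 := Real.log_nonneg (by norm_num)
  have hX1 : 1 ≤ 16 * (Real.log 64 + l + L) / ε := by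
    rw [le_div_iff₀ hε]
    linarith
  obtain ⟨n, hn1, hn2⟩ := exists_nat_pow_near hX1 (show (1 : ℝ) < 2 by norm_num)
  have hK : (2 : ℝ) ^ (n + 1) ≤ 2048 * l * (1 + L) / ε := by
    calc (2 : ℝ) ^ (n + 1) = 2 ^ n * 2 := pow_succ _ _
      _ ≤ 16 * (Real.log 64 + l + L) / ε * 2 := by gcongr
      _ = 32 * (Real.log 64 + l + L) / ε := by ring
      _ ≤ 2048 * l * (1 + L) / ε := by
          refine div_le_div_of_nonneg_right ?_ hε.le
          nlinarith
  refine ⟨n + 1, hn2.le, hK, ?_⟩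
  have hlog : ((n + 1 : ℕ) : ℝ) * Real.log 2 ≤ 2047 + Real.log l + L + L := by
    rw [← Real.log_pow]
    refine (Real.log_le_log (by positivity) hK).trans ?_
    rw [div_eq_mul_one_div, Real.log_mul (by positivity) (by positivity),
      Real.log_mul (by positivity) (by positivity), Real.log_mul (by norm_num) (by positivity),
      ← hLε]
    have h1 := Real.log_le_sub_one_of_pos (show (0 : ℝ) < 2048 by norm_num)
    have h2 := Real.log_le_sub_one_of_pos (show 0 < 1 + L by linarith)
    linarith
  have hlog2 : (1 : ℝ) / 2 ≤ Real.log 2 := by linarith [Real.log_two_gt_d9]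
  have hDhalf : ((n + 1 : ℕ) : ℝ) * (1 / 2) ≤ ((n + 1 : ℕ) : ℝ) * Real.log 2 := by gcongr
  set c := Real.log (Real.log 3)
  have hr : 1 ≤ 1 / c * Real.log l := by
    rw [one_div_mul_eq_div, one_le_div hc]
    exact hcl
  have e1 : (4110 / c + 2) * Real.log l * (1 + L) =
      4110 * (1 / c * Real.log l) * (1 + L) + 2 * Real.log l * (1 + L) := by ring
  have e2 : 4110 * 1 * (1 + L) ≤ 4110 * (1 / c * Real.log l) * (1 + L) := by gcongr
  have e3 : 0 ≤ Real.log l * L := mul_nonneg (by linarith) hL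
  rw [e1]
  nlinarith

theorem theorem8p1 :
    ∃ P : Polynomial ℝ, ∀ N : ℕ, 3 ≤ N → ∀ ε : ℝ, 0 < ε → ε < 1 →
      ∃ (𝒜 : CondAlg N (PMF (Fin N))) (q : ℕ),
        𝒜.UsesAtMost q ∧
        (q : ℝ) ≤ Real.log N * Real.log (Real.log N) / ε ^ 7 * P.eval (Real.log (1 / ε)) ∧
        𝒜.LearnsHistogram ε := by
  -- the remaining numerical factor comes from `log log N ≥ log log 3 > 0`, which absorbs constants
  set C : ℝ := 4110 / Real.log (Real.log 3) + 2 with hC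
  refine ⟨Polynomial.C (257 * 2048 * 34603009 * C) * (1 + Polynomial.X) ^ 2,
    fun N hN ε hε hε1 => ?_⟩
  have hN0 : (0 : ℝ) < N := by exact_mod_cast (by omega : 0 < N)
  have : Nonempty (PMF (Fin N)) := ⟨PMF.pure ⟨0, by omega⟩⟩
  set L := Real.log (1 / ε) with hL
  have hL0 : 0 ≤ L := Real.log_nonneg (by rw [le_div_iff₀ hε]; linarith)
  have hl3 : Real.log 3 ≤ Real.log N := Real.log_le_log (by norm_num) (by exact_mod_cast hN)
  obtain ⟨D, hD1, hD2, hD3⟩ := exists_grid_size hl3 hL0 hε hL hε1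
  set K : ℝ := 2 ^ D with hK
  have hK1 : 1 ≤ K := one_le_pow₀ (by norm_num)
  have hε4 : ε ^ 4 ≤ 1 := pow_le_one₀ hε.le hε1.le
  have hε2 : ε ^ 2 ≤ 1 := pow_le_one₀ hε.le hε1.le
  -- trials per test; `34603008 = 264 * 32 * 16 ^ 3` makes the estimator fail with probability at
  -- most `ε / 32` for the grid ratio `exp (ε / 16)`
  set n : ℕ := ⌈34603008 / ε ^ 4⌉₊ with hn
  have hn1 : 34603008 / ε ^ 4 ≤ n := Nat.le_ceil _
  have hn2 : (n : ℝ) ≤ 34603009 / ε ^ 4 := by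
    have h1 := (Nat.ceil_lt_add_one (show 0 ≤ 34603008 / ε ^ 4 by positivity)).le
    have h2 : 1 ≤ 1 / ε ^ 4 := by rwa [le_div_iff₀ (by positivity), one_mul]
    have h3 : 34603009 / ε ^ 4 = 34603008 / ε ^ 4 + 1 / ε ^ 4 := by ring
    linarith
  have hn0 : 0 < n := Nat.ceil_pos.2 (by positivity)
  have hn0' : (1 : ℝ) ≤ n := by exact_mod_cast hn0
  -- elements drawn: the `L¹` error of the histogram over `K` buckets exceeds `ε / 8` with
  -- probability at most `1 / 4`
  set s : ℕ := ⌈256 * K / ε ^ 2⌉₊ with hs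
  have hs1 : 256 * K / ε ^ 2 ≤ s := Nat.le_ceil _
  have hs2 : (s : ℝ) ≤ 257 * K / ε ^ 2 := by
    have h1 := (Nat.ceil_lt_add_one (show 0 ≤ 256 * K / ε ^ 2 by positivity)).le
    have h2 : 1 ≤ K / ε ^ 2 := by
      rw [le_div_iff₀ (by positivity), one_mul]
      linarith
    have h3 : 257 * K / ε ^ 2 = 256 * K / ε ^ 2 + K / ε ^ 2 := by ring
    linarith
  have hs0 : 0 < s := Nat.ceil_pos.2 (by positivity)
  have hs0' : (0 : ℝ) < s := by exact_mod_cast hs0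
  have hn0'' : (0 : ℝ) < n := by linarith
  refine ⟨CondAlg.histogramLearner N (ε / 16) (ε / 4) n D s, s * (n * 2 + D * n + 1),
    CondAlg.usesAtMost_histogramLearner _ _ _ _ _, ?_,
    CondAlg.histogramLearner_learns hε1 (by positivity) (by ring) hn0 hs0 ?_ ?_ ?_⟩
  · rw [Polynomial.eval_mul, Polynomial.eval_C, Polynomial.eval_pow, Polynomial.eval_add,
      Polynomial.eval_one, Polynomial.eval_X]
    push_cast
    calc (s : ℝ) * (n * 2 + D * n + 1) ≤ s * (n * (D + 3)) := by
          gcongr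
          linarith
      _ ≤ 257 * (2048 * Real.log N * (1 + L) / ε) / ε ^ 2 *
          (34603009 / ε ^ 4 * (C * Real.log (Real.log N) * (1 + L))) := by
          have : (s : ℝ) ≤ 257 * (2048 * Real.log N * (1 + L) / ε) / ε ^ 2 :=
            hs2.trans (by gcongr)
          gcongr
      _ = _ := by field_simp
  · have hlog : Real.log (64 * N / ε) = Real.log 64 + Real.log N + L := by
      rw [div_eq_mul_one_div, Real.log_mul (by positivity) (by positivity),
        Real.log_mul (by norm_num) hN0.ne']
    have h1 : Real.log (64 * N / ε) ≤ ε / 16 * K := by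
      rw [hlog]
      rw [div_le_iff₀ hε] at hD1
      linarith
    rw [Real.log_le_iff_le_exp (by positivity)] at h1
    rw [Real.exp_neg, ← div_eq_mul_inv, div_le_iff₀ (Real.exp_pos _)]
    rw [div_le_iff₀ hε] at h1
    linarith
  · rw [div_le_iff₀ (by positivity)] at hn1
    rw [div_le_div_iff₀ (by positivity) (by norm_num)]
    have : ε * (n * (ε / 16) ^ 3) = n * ε ^ 4 / 4096 := by ring
    rw [this]
    linarith
  · rw [div_le_iff₀ (by positivity)] at hs1
    rw [div_le_div_iff₀ (by positivity) (by norm_num)]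
    have : 1 * (s * (ε / 8) ^ 2) = s * ε ^ 2 / 64 := by ring
    rw [this]
    linarith
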